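/- Let $M_1\ge 0$, $r\ge 1$ and $M_2\ge r$ be integers and $M=M_1+M_2$. Let $X\in\mathbb R^{M\times r}$ be a random matrix whose entries are independent $\mathcal N(0,1/M)$ variables, and let $U=X(X^\top X)^{-1/2}$ be the associated random column-orthonormal matrix (well defined with probability one). Write $u_1^\top,\dots,u_M^\top$ for the rows of $U$, $U^{(2)}\in\mathbb R^{M_2\times r}$ for the block of its last $M_2$ rows, and call $M_1+1,\dots,M$ the shuffled indices. Let $\varphi$ be a fixed permutation of $\{1,\dots,M\}$ with $\varphi(i)=i$ for $i\le M_1$, and with $\varphi(i)\ne i$ and $\varphi(\varphi(i))\neq i$ for $i>M_1$ (so $\varphi$ preserves the set of shuffled indices). Let $\tilde\pi$ be the permutation matrix with rows $e_{\varphi(1)}^\top,\dots,e_{\varphi(M)}^\top$ and $\pi$ its lower right $M_2\times M_2$ block. For a shuffled index $m$ (for instance $m=M$) put $$\alpha=U^{(2)}u_m,\qquad \tau^{(2)}=(I-\pi)U^{(2)},\qquad \mathrm{term}_1=\alpha^\top\tau^{(2)}\tau^{(2)\top}\alpha ,$$ $$\tau=(I-\tilde\pi)U,\qquad \kappa=Uu_m-e_m,\qquad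 \sigma_\eta^2=\tfrac1r\,\kappa^\top\tau\tau^\top\kappa .$$ Let $\Gamma_p(x)=\pi^{p(p-1)/4}\prod_{i=1}^p\Gamma\!\left(x-\tfrac{i-1}{2}\right)$ (here $\pi$ is the number), and for an integer $a\geq r$ let $$G_r(a,M)=\frac{\Gamma_r\!\left(\frac a2+\frac3r\right)\Gamma_r\!\left(\frac M2\right)}{\Gamma_r\!\left(\frac M2+\frac3r\right)\Gamma_r\!\left(\frac a2\right)} .$$ Then $\mathrm{term}_1$, $\det(U^{(2)\top}U^{(2)})^{3/r}$ and $\sigma_\eta^2$ are integrable, and 1. $\displaystyle \mathbb E(\mathrm{term}_1)\ \ge\ \frac{r}{M_2}\,\mathbb E\!\left[\det\!\big(U^{(2)\top}U^{(2)}\big)^{3/r}\right]$; 2. $\displaystyle \mathbb E\!\left[\det\!\big(U^{(2)\top}U^{(2)}\big)^{3/r}\right]=G_r(M_2,M)=\frac{\Gamma_r\!\left(\frac{M_2}2+\frac3r\right)\Gamma_r\!\left(\frac M2\right)}{\Gamma_r\!\left(\frac M2+\frac3r\right)\Gamma_r\!\left(\frac{M_2}2\right)}$; 3. in particular, $\displaystyle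 \mathbb E(\mathrm{term}_1)\ \ge\ \frac r{M_2}\,G_r(r,M)=\frac r{M_2}\cdot\frac{\Gamma_r\!\left(\frac r2+\frac3r\right)\Gamma_r\!\left(\frac M2\right)}{\Gamma_r\!\left(\frac M2+\frac3r\right)\Gamma_r\!\left(\frac r2\right)}$; 4. $\displaystyle \mathbb E(\sigma_\eta^2)\ \ge\ \frac2M-2\,\frac{(M_2M+M-4)(M-r)}{M^2(M-1)(M+2)}-\frac{4r}{M^2}+\frac{1}{M_2}\,G_r(M_2,M)$. -/

import Mathlib

open MeasureTheory ProbabilityTheory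

/-- `X` is a random matrix with independent centred Gaussian entries of variance `v`. -/
def IsGaussianMatrix {Ω : Type*} [MeasurableSpace Ω] {m n : Type*}
    (X : Ω → Matrix m n ℝ) (v : NNReal) (P : Measure Ω) : Prop :=
  (∀ i k, HasLaw (fun ω => X ω i k) (gaussianReal 0 v) P) ∧
    iIndepFun (fun (p : m × n) ω => X ω p.1 p.2) P

/-- The column-orthonormal matrix `X (Xᵀ X)^(-1/2)`. The power is taken through the spectral
decomposition of the symmetric matrix `Xᵀ X`. -/
noncomputable def orthonormalize {m n : Type*} [Fintype m] [Fintype n] [DecidableEq n]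
    (X : Matrix m n ℝ) : Matrix m n ℝ :=
  X * cfc (fun x : ℝ => x ^ (-(1 / 2) : ℝ)) (X.transpose * X)

/-- The multivariate gamma function
`Γ_p(x) = π^(p(p-1)/4) ∏_{i=1}^p Γ(x - (i-1)/2)`. -/
noncomputable def multiGamma (p : ℕ) (x : ℝ) : ℝ :=
  Real.pi ^ ((p : ℝ) * ((p : ℝ) - 1) / 4) *
    ∏ i ∈ Finset.Icc 1 p, Real.Gamma (x - ((i : ℝ) - 1) / 2)

section Shuffle

variable {M₁ M₂ r : ℕ}

/-- The Gram matrix `U⁽²⁾ᵀ U⁽²⁾` of the lower (shuffled) block. -/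
def gram₂ (U : Matrix (Fin M₁ ⊕ Fin M₂) (Fin r) ℝ) : Matrix (Fin r) (Fin r) ℝ :=
  U.toRows₂.transpose * U.toRows₂

/-- `α = U⁽²⁾ u_m`, where `u_m` is the row of `U` at the shuffled index `m`. -/
def alphaVec (U : Matrix (Fin M₁ ⊕ Fin M₂) (Fin r) ℝ) (m : Fin M₂) : Fin M₂ → ℝ :=
  U.toRows₂.mulVec (U (Sum.inr m))

/-- `τ⁽²⁾ = (I - π) U⁽²⁾`, where `π` is the permutation matrix with rows `e_{φ(i)}ᵀ`. -/
def tau₂ (φ : Equiv.Perm (Fin M₂)) (U : Matrix (Fin M₁ ⊕ Fin M₂) (Fin r) ℝ) :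
    Matrix (Fin M₂) (Fin r) ℝ :=
  (1 - φ.permMatrix ℝ) * U.toRows₂

/-- `term₁ = αᵀ τ⁽²⁾ τ⁽²⁾ᵀ α`. -/
def term₁ (φ : Equiv.Perm (Fin M₂)) (m : Fin M₂)
    (U : Matrix (Fin M₁ ⊕ Fin M₂) (Fin r) ℝ) : ℝ :=
  alphaVec U m ⬝ᵥ (tau₂ φ U * (tau₂ φ U).transpose).mulVec (alphaVec U m)

/-- `τ = (I - π̃) U`, where `π̃` fixes the first `M₁` indices and acts as `φ` on the others. -/
def tauFull (φ : Equiv.Perm (Fin M₂)) (U : Matrix (Fin M₁ ⊕ Fin M₂) (Fin r) ℝ) :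
    Matrix (Fin M₁ ⊕ Fin M₂) (Fin r) ℝ :=
  (1 - (Equiv.Perm.sumCongr (1 : Equiv.Perm (Fin M₁)) φ).permMatrix ℝ) * U

/-- `κ = U u_m - e_m`. -/
def kappaVec (U : Matrix (Fin M₁ ⊕ Fin M₂) (Fin r) ℝ) (m : Fin M₂) : Fin M₁ ⊕ Fin M₂ → ℝ :=
  U.mulVec (U (Sum.inr m)) - Pi.single (Sum.inr m) 1

/-- `σ_η² = (1/r) κᵀ τ τᵀ κ`. -/
noncomputable def sigmaEtaSq (φ : Equiv.Perm (Fin M₂)) (m : Fin M₂)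
    (U : Matrix (Fin M₁ ⊕ Fin M₂) (Fin r) ℝ) : ℝ :=
  1 / (r : ℝ) *
    (kappaVec U m ⬝ᵥ (tauFull φ U * (tauFull φ U).transpose).mulVec (kappaVec U m))

end Shuffle

/-- `Γ_r(a/2 + 3/r) Γ_r(M/2) / (Γ_r(M/2 + 3/r) Γ_r(a/2))`. -/
noncomputable def gammaRatio (r a M : ℕ) : ℝ :=
  (multiGamma r ((a : ℝ) / 2 + 3 / r) * multiGamma r ((M : ℝ) / 2)) /
    (multiGamma r ((M : ℝ) / 2 + 3 / r) * multiGamma r ((a : ℝ) / 2))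

/-! ### Standard Gaussian vectors: density, polar coordinates, beta moments. -/

section StdGaussian

open Module

variable {E : Type*} [NormedAddCommGroup E] [InnerProductSpace ℝ E] [FiniteDimensional ℝ E]
  [MeasurableSpace E] [BorelSpace E]

/-! All quantities depend on `U` only through the Gram matrix of its lower block and `H = U Uᵀ`.
Almost surely `H` is the orthogonal projection onto the column space of `X`, of rank `r`, and its
law is invariant under orthogonal conjugation because Gaussian columns are rotation invariant.

Lower bound for `term₁` (`integral_trace_cube_le`): write it as a sum over `i, j` of `H_im D_ij
H_jm`, where `D` has four terms. The two terms containing just one of `φ i`, `φ j` have mean zero,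
since changing the sign of one coordinate reverses them. The term with both is a positive
semidefinite quadratic form. What remains is the `m`-th diagonal entry of `B³`, with `B` the lower
block of `H`; by exchangeability its mean is `E tr B³ / M₂`. Finally `tr B³ = tr G³` for `G = U⁽²⁾ᵀ
U⁽²⁾`, and AM-GM on the eigenvalues gives `tr G³ ≥ r (det G)^(3/r)`.

Determinant moment (`lintegral_det_gram_ratio_rpow`): `det G` is the quotient of the Gram
determinants of the lower block of `X` and of `X`. Adding one column multiplies the quotient by a
ratio of squared norms of Gaussian vectors in orthogonal complements, whose moments are those of a
beta variable. The product of these moments is the quotient of multivariate gamma functions.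
Log-convexity of `Γ` makes it monotone in `a`, which gives the third claim.

Bound for `σ_η²` (`integral_sigma`): besides `term₁`, only first and second moments of `H` occur.
Sign changes remove most of them, and `E H_ii²`, `E H_ij²`, `E H_ii H_jj` are determined by three
linear equations: idempotence, the trace, and invariance under one reflection. -/

/-- The density of the standard Gaussian distribution with respect to the Lebesgue measure. -/
noncomputable def stdGaussianDensity (d : ℕ) (t : ℝ) : ℝ :=
  (2 * Real.pi) ^ (-(d : ℝ) / 2) * Real.exp (-(1 / 2) * t ^ 2)

lemma stdGaussianDensity_nonneg (d : ℕ) (t : ℝ) : 0 ≤ stdGaussianDensity d t := by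
  unfold stdGaussianDensity; positivity

lemma integral_stdGaussianDensity :
    ∫ x : E, stdGaussianDensity (finrank ℝ E) ‖x‖ = 1 := by
  unfold stdGaussianDensity
  rw [integral_const_mul, GaussianFourier.integral_rexp_neg_mul_sq_norm (by norm_num),
    show Real.pi / (1 / 2) = 2 * Real.pi by ring, ← Real.rpow_add (by positivity)]
  simp [neg_div]

lemma integrable_stdGaussianDensity :
    Integrable (fun x : E => stdGaussianDensity (finrank ℝ E) ‖x‖) :=
  .of_integral_ne_zero (by rw [integral_stdGaussianDensity]; exact one_ne_zero)

-- Both sides are finite measures, so it is enough to compare characteristic functions; the one on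
-- the right is a Gaussian Fourier integral.
variable (E) in
lemma stdGaussian_eq_withDensity :
    stdGaussian E = (volume : Measure E).withDensity
      (fun x => ENNReal.ofReal (stdGaussianDensity (finrank ℝ E) ‖x‖)) := by
  have hm : Measurable fun x : E => ENNReal.ofReal (stdGaussianDensity (finrank ℝ E) ‖x‖) := by
    unfold stdGaussianDensity; fun_prop
  have : IsFiniteMeasure ((volume : Measure E).withDensity
      (fun x => ENNReal.ofReal (stdGaussianDensity (finrank ℝ E) ‖x‖))) :=
    isFiniteMeasure_withDensity_ofReal integrable_stdGaussianDensity.2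
  apply Measure.ext_of_charFun
  ext t
  rw [charFun_stdGaussian, charFun_apply, integral_withDensity_eq_integral_toReal_smul hm
    (.of_forall fun _ => ENNReal.ofReal_lt_top)]
  have h1 : ∀ x : E, (ENNReal.ofReal (stdGaussianDensity (finrank ℝ E) ‖x‖)).toReal •
      Complex.exp (inner ℝ x t * Complex.I) = (((2 * Real.pi) ^ (-(finrank ℝ E : ℝ) / 2) : ℝ) : ℂ)
        * Complex.exp (-(1 / 2 : ℂ) * ‖x‖ ^ 2 + Complex.I * inner ℝ t x) := by
    intro x
    rw [ENNReal.toReal_ofReal (stdGaussianDensity_nonneg _ _), Complex.exp_add, stdGaussianDensity,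
      Complex.real_smul, real_inner_comm]
    push_cast
    ring_nf
  simp_rw [h1]
  rw [integral_const_mul, GaussianFourier.integral_cexp_neg_mul_sq_norm_add (by norm_num),
    ← mul_assoc]
  have h2 : (((2 * Real.pi) ^ (-(finrank ℝ E : ℝ) / 2) : ℝ) : ℂ) *
      ((Real.pi : ℂ) / (1 / 2)) ^ ((finrank ℝ E : ℂ) / 2) = 1 := by
    rw [show (Real.pi : ℂ) / (1 / 2) = ((2 * Real.pi : ℝ) : ℂ) by push_cast; ring,
      show ((finrank ℝ E : ℂ) / 2) = (((finrank ℝ E : ℝ) / 2 : ℝ) : ℂ) by push_cast; ring,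
      ← Complex.ofReal_cpow (by positivity), ← Complex.ofReal_mul,
      ← Real.rpow_add (by positivity)]
    simp [neg_div]
  rw [h2, one_mul, Complex.I_sq]
  congr 1
  ring

lemma integral_stdGaussian (f : E → ℝ) :
    ∫ x, f x ∂(stdGaussian E) = ∫ x, stdGaussianDensity (finrank ℝ E) ‖x‖ * f x := by
  rw [stdGaussian_eq_withDensity, integral_withDensity_eq_integral_toReal_smul
    (by unfold stdGaussianDensity; fun_prop) (.of_forall fun _ => ENNReal.ofReal_lt_top)]
  simp_rw [ENNReal.toReal_ofReal (stdGaussianDensity_nonneg _ _), smul_eq_mul]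

/-- Integration in polar coordinates of a product of an angular and a radial function. -/
lemma integral_mul_fun_norm [Nontrivial E] (f : E → ℝ) (hf : ∀ (c : ℝ) x, 0 < c → f (c • x) = f x) (h : ℝ → ℝ) :
    ∫ x, f x * h ‖x‖ = (∫ s : Metric.sphere (0 : E) 1, f s ∂(volume : Measure E).toSphere) *
      ∫ y : Set.Ioi (0 : ℝ), h y ∂(Measure.volumeIoiPow (finrank ℝ E - 1)) := by
  calc
    ∫ x, f x * h ‖x‖ = ∫ x : ({(0)}ᶜ : Set E), f x.1 * h (‖x.1‖) ∂((volume : Measure E).comap (↑)) := by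
      rw [integral_subtype_comap (measurableSet_singleton _).compl fun x ↦ f x * h (‖x‖),
        restrict_compl_singleton]
    _ = ∫ x : Metric.sphere (0 : E) 1 × Set.Ioi (0 : ℝ), f x.1 * h x.2 ∂(volume : Measure E).toSphere.prod
        (.volumeIoiPow (finrank ℝ E - 1)) := by
      rw [← (volume : Measure E).measurePreserving_homeomorphUnitSphereProd.integral_comp
        (Homeomorph.measurableEmbedding _)]
      refine integral_congr_ae (.of_forall fun x => ?_)
      have hx : 0 < ‖x.1‖ := norm_pos_iff.2 x.2
      simp only [homeomorphUnitSphereProd_apply_snd_coe, homeomorphUnitSphereProd_apply_fst_coe]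
      -- Homogeneity of degree zero lets the direction `x / ‖x‖` replace `x`.
      rw [hf _ _ (inv_pos.2 hx)]
    _ = _ := integral_prod_mul (fun s : Metric.sphere (0 : E) 1 => f s)
        (fun y : Set.Ioi (0 : ℝ) => h y)

/-- Under the standard Gaussian distribution the direction and the norm are independent. -/
lemma integral_stdGaussian_mul_fun_norm [Nontrivial E]
    (f : E → ℝ) (hf : ∀ (c : ℝ) x, 0 < c → f (c • x) = f x)
    (g : ℝ → ℝ) :
    ∫ x, f x * g ‖x‖ ∂(stdGaussian E) =
      (∫ x, f x ∂(stdGaussian E)) * ∫ x, g ‖x‖ ∂(stdGaussian E) := by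
  have h1 : ∫ x : E, (1 : ℝ) * stdGaussianDensity (finrank ℝ E) ‖x‖ = 1 := by
    simp_rw [one_mul]; exact integral_stdGaussianDensity
  have e1 : ∀ x : E, stdGaussianDensity (finrank ℝ E) ‖x‖ * (f x * g ‖x‖) =
    f x * (stdGaussianDensity (finrank ℝ E) ‖x‖ * g ‖x‖) := fun x => by ring
  have e2 : ∀ x : E, stdGaussianDensity (finrank ℝ E) ‖x‖ * f x =
    f x * stdGaussianDensity (finrank ℝ E) ‖x‖ := fun x => by ring
  have e3 : ∀ x : E, stdGaussianDensity (finrank ℝ E) ‖x‖ * g ‖x‖ =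
    1 * (stdGaussianDensity (finrank ℝ E) ‖x‖ * g ‖x‖) := fun x => by ring
  rw [integral_stdGaussian, integral_stdGaussian, integral_stdGaussian]
  simp_rw [e1, e2]
  rw [integral_congr_ae (.of_forall e3), integral_mul_fun_norm f hf
      (fun t => stdGaussianDensity (finrank ℝ E) t * g t),
    integral_mul_fun_norm f hf (stdGaussianDensity (finrank ℝ E)),
    integral_mul_fun_norm (fun _ => 1) (fun _ _ _ => rfl)
      (fun t => stdGaussianDensity (finrank ℝ E) t * g t)]
  rw [integral_mul_fun_norm (fun _ => 1) (fun _ _ _ => rfl)] at h1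
  -- The two sides differ by the factor (mass of the sphere) × (radial mass of the density), which
  -- `h1` says is one.
  linear_combination (-(∫ s : Metric.sphere (0 : E) 1, f s ∂(volume : Measure E).toSphere) *
    ∫ y : Set.Ioi (0 : ℝ), stdGaussianDensity (finrank ℝ E) y * g y
      ∂(Measure.volumeIoiPow (finrank ℝ E - 1))) * h1

/-- Moments of the norm of a standard Gaussian vector. -/
lemma integral_norm_rpow_stdGaussian [Nontrivial E] {s : ℝ} (hs : 0 ≤ s) :
    ∫ x, (‖x‖ ^ 2) ^ s ∂(stdGaussian E) =
      2 ^ s * Real.Gamma ((finrank ℝ E : ℝ) / 2 + s) / Real.Gamma ((finrank ℝ E : ℝ) / 2) := by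
  have hd : (0 : ℝ) < finrank ℝ E := by exact_mod_cast finrank_pos
  have key : ∀ q : ℝ, 0 ≤ q → ∫ x : E, stdGaussianDensity (finrank ℝ E) ‖x‖ * (‖x‖ ^ 2) ^ q =
      (finrank ℝ E * (volume : Measure E).real (Metric.ball 0 1) *
        (2 * Real.pi) ^ (-(finrank ℝ E : ℝ) / 2) * ((1 / 2 : ℝ) ^ (-(finrank ℝ E : ℝ) / 2) / 2)) *
        (2 ^ q * Real.Gamma ((finrank ℝ E : ℝ) / 2 + q)) := by
    intro q hq
    rw [integral_fun_norm_addHaar volume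
      (fun t => stdGaussianDensity (finrank ℝ E) t * (t ^ 2) ^ q)]
    have : ∀ t ∈ Set.Ioi (0 : ℝ), t ^ (finrank ℝ E - 1) •
        (stdGaussianDensity (finrank ℝ E) t * (t ^ 2) ^ q) =
        (2 * Real.pi) ^ (-(finrank ℝ E : ℝ) / 2) *
          (t ^ ((finrank ℝ E : ℝ) - 1 + 2 * q) * Real.exp (-(1 / 2) * t ^ (2 : ℝ))) := by
      intro t ht
      have ht : 0 < t := ht
      have e : t ^ (finrank ℝ E - 1) * (t ^ 2) ^ q = t ^ ((finrank ℝ E : ℝ) - 1 + 2 * q) := by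
        rw [← Real.rpow_natCast, ← Real.rpow_natCast, ← Real.rpow_mul ht.le, ← Real.rpow_add ht,
          Nat.cast_sub finrank_pos]
        simp
      rw [← e, stdGaussianDensity, smul_eq_mul, Real.rpow_two]
      ring
    rw [setIntegral_congr_fun measurableSet_Ioi this, integral_const_mul,
      integral_rpow_mul_exp_neg_mul_rpow (by norm_num) (by linarith) (by norm_num)]
    have e1 : ((finrank ℝ E : ℝ) - 1 + 2 * q + 1) / 2 = (finrank ℝ E : ℝ) / 2 + q := by ring
    have e2 : (1 / 2 : ℝ) ^ (-((finrank ℝ E : ℝ) - 1 + 2 * q + 1) / 2) =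
        (1 / 2 : ℝ) ^ (-(finrank ℝ E : ℝ) / 2) * 2 ^ q := by
      rw [show -((finrank ℝ E : ℝ) - 1 + 2 * q + 1) / 2 = -(finrank ℝ E : ℝ) / 2 + -q by ring,
        Real.rpow_add (by norm_num), one_div, Real.inv_rpow (by norm_num) (-q),
        Real.rpow_neg (by norm_num) q, inv_inv]
    rw [e1, e2, nsmul_eq_mul, smul_eq_mul]
    ring
  -- The case `q = 0` fixes the constant in `key`, so the volume of the ball is never evaluated.
  have h0 := key 0 le_rfl
  simp only [Real.rpow_zero, mul_one, one_mul, add_zero] at h0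
  rw [integral_stdGaussianDensity] at h0
  rw [integral_stdGaussian, key s hs]
  have hG : Real.Gamma ((finrank ℝ E : ℝ) / 2) ≠ 0 := (Real.Gamma_pos_of_pos (by positivity)).ne'
  rw [eq_div_iff hG]
  linear_combination (-2 ^ s * Real.Gamma ((finrank ℝ E : ℝ) / 2 + s)) * h0

/-- A co-isometry maps the standard Gaussian distribution to the standard Gaussian distribution. -/
lemma stdGaussian_map_of_norm_adjoint {F : Type*} [NormedAddCommGroup F] [InnerProductSpace ℝ F]
    [FiniteDimensional ℝ F] [MeasurableSpace F] [BorelSpace F] (T : E →L[ℝ] F)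
    (hT : ∀ y, ‖ContinuousLinearMap.adjoint T y‖ = ‖y‖) :
    (stdGaussian E).map T = stdGaussian F := by
  have : IsProbabilityMeasure ((stdGaussian E).map T) :=
    Measure.isProbabilityMeasure_map (by fun_prop)
  apply Measure.ext_of_charFun
  ext t
  rw [charFun_apply, integral_map (by fun_prop) (by fun_prop)]
  simp_rw [← ContinuousLinearMap.adjoint_inner_right]
  rw [← charFun_apply, charFun_stdGaussian, charFun_stdGaussian, hT]

omit [MeasurableSpace E] [BorelSpace E] in
lemma norm_le_of_norm_adjoint {F : Type*} [NormedAddCommGroup F] [InnerProductSpace ℝ F]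
    [FiniteDimensional ℝ F] {T : E →L[ℝ] F}
    (hT : ∀ y, ‖ContinuousLinearMap.adjoint T y‖ = ‖y‖) (x : E) : ‖T x‖ ≤ ‖x‖ := by
  have h : ‖ContinuousLinearMap.adjoint T‖ ≤ 1 :=
    ContinuousLinearMap.opNorm_le_bound _ zero_le_one fun y => by rw [hT, one_mul]
  rw [LinearIsometryEquiv.norm_map] at h
  simpa using T.le_of_opNorm_le h x

lemma stdGaussian_singleton_zero [Nontrivial E] : stdGaussian E {0} = 0 := by
  rw [stdGaussian_eq_withDensity]
  exact withDensity_absolutelyContinuous _ _ (measure_singleton _)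

/-- The moments of a beta distribution, as the ratio of squared norms of a Gaussian vector and of
its image under a co-isometry. -/
lemma integral_norm_ratio_rpow_stdGaussian {F : Type*} [NormedAddCommGroup F]
    [InnerProductSpace ℝ F] [FiniteDimensional ℝ F] [MeasurableSpace F] [BorelSpace F]
    [Nontrivial E] [Nontrivial F] (T : E →L[ℝ] F)
    (hT : ∀ y, ‖ContinuousLinearMap.adjoint T y‖ = ‖y‖) {s : ℝ} (hs : 0 ≤ s) :
    ∫ x, (‖T x‖ ^ 2 / ‖x‖ ^ 2) ^ s ∂(stdGaussian E) =
      Real.Gamma ((finrank ℝ F : ℝ) / 2 + s) * Real.Gamma ((finrank ℝ E : ℝ) / 2) /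
        (Real.Gamma ((finrank ℝ E : ℝ) / 2 + s) * Real.Gamma ((finrank ℝ F : ℝ) / 2)) := by
  -- The ratio is scale invariant, hence uncorrelated with powers of `‖x‖`; multiplied by `(‖x‖²)^s`
  -- it becomes a norm moment on `F`. The wanted moment is thus a quotient of two norm moments.
  have h := integral_stdGaussian_mul_fun_norm (fun x : E => (‖T x‖ ^ 2 / ‖x‖ ^ 2) ^ s)
    (fun c x hc => by
      simp only [map_smul, norm_smul]
      rw [mul_pow, mul_pow, mul_div_mul_left]
      simp [hc.ne']) (fun t => (t ^ 2) ^ s)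
  have e : ∫ x, (‖T x‖ ^ 2 / ‖x‖ ^ 2) ^ s * (‖x‖ ^ 2) ^ s ∂(stdGaussian E) =
      ∫ y, (‖y‖ ^ 2) ^ s ∂(stdGaussian F) := by
    rw [← stdGaussian_map_of_norm_adjoint T hT, integral_map (by fun_prop)
      (Measurable.aestronglyMeasurable (by fun_prop))]
    have hne : ∀ᵐ x ∂(stdGaussian E), x ≠ 0 := by
      rw [ae_iff]; simpa using stdGaussian_singleton_zero (E := E)
    refine integral_congr_ae (hne.mono fun x hx => ?_)
    have hx : 0 < ‖x‖ := norm_pos_iff.2 hx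
    simp only
    rw [← Real.mul_rpow (by positivity) (by positivity), div_mul_cancel₀ _ (by positivity)]
  rw [e, integral_norm_rpow_stdGaussian hs, integral_norm_rpow_stdGaussian hs] at h
  have hE : (0 : ℝ) < finrank ℝ E := by exact_mod_cast finrank_pos
  have hF : (0 : ℝ) < finrank ℝ F := by exact_mod_cast finrank_pos
  have g1 := (Real.Gamma_pos_of_pos (show (0 : ℝ) < (finrank ℝ E : ℝ) / 2 by positivity)).ne'
  have g2 := (Real.Gamma_pos_of_pos (show (0 : ℝ) < (finrank ℝ F : ℝ) / 2 by positivity)).ne'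
  have g3 := (Real.Gamma_pos_of_pos (show (0 : ℝ) < (finrank ℝ E : ℝ) / 2 + s by positivity)).ne'
  have g4 : (2 : ℝ) ^ s ≠ 0 := by positivity
  field_simp at h ⊢
  linear_combination -h

end StdGaussian
-- Gram determinants of Gaussian vectors, one column at a time.
section GramDeterminant

lemma measurable_fin_cons {E : Type*} [MeasurableSpace E] {n : ℕ} :
    Measurable fun p : E × (Fin n → E) => (Fin.cons p.1 p.2 : Fin (n + 1) → E) := by
  refine measurable_pi_lambda _ fun i => ?_
  cases i using Fin.cases with
  | zero => exact measurable_fst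
  | succ i => exact (measurable_pi_apply i).comp measurable_snd

open Module

variable {E F : Type*} [NormedAddCommGroup E] [InnerProductSpace ℝ E] [FiniteDimensional ℝ E]
  [NormedAddCommGroup F] [InnerProductSpace ℝ F] [FiniteDimensional ℝ F]

omit [FiniteDimensional ℝ E] in
lemma det_gram_nonneg {n : Type*} [Fintype n] [DecidableEq n] (v : n → E) :
    0 ≤ (Matrix.gram ℝ v).det := (Matrix.posSemidef_gram ℝ v).det_nonneg

/-- Adding a vector multiplies the Gram determinant by the squared distance to the span. -/
lemma det_gram_cons {n : ℕ} (x : E) (v : Fin n → E) :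
    (Matrix.gram ℝ (Fin.cons x v : Fin (n + 1) → E)).det =
      ‖(Submodule.span ℝ (Set.range v))ᗮ.orthogonalProjectionOnto x‖ ^ 2 * (Matrix.gram ℝ v).det := by
  set K := Submodule.span ℝ (Set.range v) with hK
  set q := Kᗮ.starProjection x with hq
  have hqK : q ∈ Kᗮ := Submodule.starProjection_apply_mem _ _
  have hqv : ∀ i, inner ℝ q (v i) = 0 := fun i =>
    (Submodule.mem_orthogonal' _ _).1 hqK _ (Submodule.subset_span ⟨i, rfl⟩)
  have hxq : x - q ∈ K := by
    have h := Submodule.sub_starProjection_mem_orthogonal (K := Kᗮ) x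
    rwa [Submodule.orthogonal_orthogonal] at h
  obtain ⟨c, hc⟩ := (Submodule.mem_span_range_iff_exists_fun ℝ).1 hxq
  -- Subtracting the component of `x` in `K` is a row operation; it turns the first row into `(⟨q,
  -- x⟩, 0, …, 0)`.
  have h1 := Matrix.det_updateRow_sum (Matrix.gram ℝ (Fin.cons x v : Fin (n + 1) → E)) 0
    (Fin.cons 1 (fun i => -c i) : Fin (n + 1) → ℝ)
  have h2 : (∑ k, (Fin.cons 1 (fun i => -c i) : Fin (n + 1) → ℝ) k •
      Matrix.gram ℝ (Fin.cons x v : Fin (n + 1) → E) k) =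
      fun j => inner ℝ q ((Fin.cons x v : Fin (n + 1) → E) j) := by
    ext j
    have hq' : q = x - ∑ i, c i • v i := by rw [hc]; abel
    rw [hq', inner_sub_left, sum_inner]
    simp [Fin.sum_univ_succ, inner_smul_left, sub_eq_add_neg]
  rw [h2] at h1
  simp only [Fin.cons_zero, one_smul] at h1
  rw [← h1, Matrix.det_succ_row_zero, Fin.sum_univ_succ]
  have h3 : ∀ i : Fin n, inner ℝ q ((Fin.cons x v : Fin (n + 1) → E) i.succ) = 0 := by
    simpa using hqv
  have h4 : inner ℝ q x = ‖Kᗮ.orthogonalProjectionOnto x‖ ^ 2 := by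
    have : x = q + (x - q) := by abel
    nth_rw 1 [this]
    rw [inner_add_right, (Submodule.mem_orthogonal' _ _).1 hqK _ hxq, add_zero,
      real_inner_self_eq_norm_sq]
    rfl
  have h5 : ((Matrix.gram ℝ (Fin.cons x v : Fin (n + 1) → E)).updateRow 0
      fun j => inner ℝ q ((Fin.cons x v : Fin (n + 1) → E) j)).submatrix Fin.succ
        (Fin.succAbove 0) = Matrix.gram ℝ v := by
    ext i j
    simp [Matrix.updateRow_apply]
  simp only [Matrix.updateRow_self, Fin.cons_zero, h3, h4, h5]
  simp

variable [MeasurableSpace E] [BorelSpace E] [MeasurableSpace F] [BorelSpace F]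

lemma stdGaussian_map_orthogonalProjection (K : Submodule ℝ E) :
    (stdGaussian E).map K.orthogonalProjectionOnto = stdGaussian K :=
  stdGaussian_map_of_norm_adjoint _ fun y => by
    rw [Submodule.adjoint_orthogonalProjectionOnto]; rfl

lemma measurable_det_gram {n : Type*} [Fintype n] [DecidableEq n] :
    Measurable fun v : n → E => (Matrix.gram ℝ v).det := by
  refine Continuous.measurable (Continuous.matrix_det ?_)
  refine continuous_matrix fun i j => ?_
  simp only [Matrix.gram_apply]
  fun_prop

omit [MeasurableSpace E] [BorelSpace E] [MeasurableSpace F] [BorelSpace F] in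
lemma finrank_le_of_norm_adjoint {T : E →L[ℝ] F}
    (hT : ∀ y, ‖ContinuousLinearMap.adjoint T y‖ = ‖y‖) : finrank ℝ F ≤ finrank ℝ E := by
  refine LinearMap.finrank_le_finrank_of_injective
    (f := (ContinuousLinearMap.adjoint T).toLinearMap) ?_
  refine (injective_iff_map_eq_zero _).2 fun y hy => ?_
  have := hT y
  rw [show ContinuousLinearMap.adjoint T y = 0 from hy, norm_zero] at this
  exact norm_eq_zero.1 this.symm

lemma lintegral_pi_stdGaussian_succ {n : ℕ} {f : (Fin (n + 1) → E) → ENNReal}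
    (hf : Measurable f) :
    ∫⁻ v, f v ∂(Measure.pi fun _ : Fin (n + 1) => stdGaussian E) =
      ∫⁻ v, ∫⁻ x, f (Fin.cons x v) ∂(stdGaussian E)
        ∂(Measure.pi fun _ : Fin n => stdGaussian E) := by
  have h := (measurePreserving_piFinSuccAbove (fun _ : Fin (n + 1) => stdGaussian E) 0).symm
  have he : ∀ p : E × (Fin n → E),
      (MeasurableEquiv.piFinSuccAbove (fun _ : Fin (n + 1) => E) 0).symm p = Fin.cons p.1 p.2 :=
    fun p => Fin.insertNth_zero' p.1 p.2
  rw [← h.lintegral_comp hf]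
  simp_rw [he]
  exact lintegral_prod_symm' _ (hf.comp measurable_fin_cons)

/-- For independent `v` with fewer vectors than the dimension, the determinant vanishes only if the
new vector projects to zero on the orthogonal complement of the span. That projection is standard
Gaussian on a nontrivial space, so this is a null event. -/
lemma ae_det_gram_ne_zero {n : ℕ} (hn : n ≤ finrank ℝ E) :
    ∀ᵐ v ∂(Measure.pi fun _ : Fin n => stdGaussian E), (Matrix.gram ℝ v).det ≠ 0 := by
  induction n with
  | zero => simp
  | succ n ih =>
    have hm : MeasurableSet {v : Fin (n + 1) → E | (Matrix.gram ℝ v).det = 0} :=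
      measurable_det_gram (measurableSet_singleton 0)
    have h0 : (Measure.pi fun _ : Fin (n + 1) => stdGaussian E)
        {v | (Matrix.gram ℝ v).det = 0} = 0 := by
      rw [← lintegral_indicator_one hm, lintegral_pi_stdGaussian_succ
        (measurable_one.indicator hm)]
      have hmi : Measurable fun p : E × (Fin n → E) =>
          {v : Fin (n + 1) → E | (Matrix.gram ℝ v).det = 0}.indicator (1 : (Fin (n + 1) → E) → ENNReal)
            (Fin.cons p.1 p.2) := (measurable_one.indicator hm).comp measurable_fin_cons
      rw [lintegral_eq_zero_iff (hmi.lintegral_prod_left' (μ := stdGaussian E))]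
      filter_upwards [ih (by omega)] with v hv
      have hli := Matrix.linearIndependent_of_det_gram_ne_zero hv
      set K := Submodule.span ℝ (Set.range v) with hK
      have hKn : finrank ℝ K = n := by rw [finrank_span_eq_card hli, Fintype.card_fin]
      have : Nontrivial Kᗮ := by
        apply nontrivial_of_finrank_pos (R := ℝ)
        have := K.finrank_add_finrank_orthogonal
        omega
      have hs := stdGaussian_singleton_zero (E := Kᗮ)
      rw [← stdGaussian_map_orthogonalProjection,
        Measure.map_apply (by fun_prop) (measurableSet_singleton 0)] at hs
      simp only [Pi.zero_apply]
      have hmv : Measurable fun x : E => {v : Fin (n + 1) → E | (Matrix.gram ℝ v).det = 0}.indicator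
          (1 : (Fin (n + 1) → E) → ENNReal) (Fin.cons x v) := hmi.comp measurable_prodMk_right
      rw [lintegral_eq_zero_iff hmv]
      refine (measure_mono_null ?_ hs)
      intro x hx
      simp only [Set.mem_compl_iff, Set.mem_ofPred_eq, Pi.zero_apply, Set.indicator_apply_eq_zero,
        not_forall, det_gram_cons] at hx
      exact norm_eq_zero.1 (pow_eq_zero_iff two_ne_zero |>.1
        ((mul_eq_zero.1 hx.1).resolve_right hv))
    rw [ae_iff]
    simpa using h0

/-- The moments of the ratio of the Gram determinants of independent Gaussian vectors and of their
images under a co-isometry. -/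
lemma lintegral_det_gram_ratio_rpow (T : E →L[ℝ] F)
    (hT : ∀ y, ‖ContinuousLinearMap.adjoint T y‖ = ‖y‖) {s : ℝ} (hs : 0 ≤ s) {n : ℕ}
    (hn : n ≤ finrank ℝ F) :
    ∫⁻ v, ENNReal.ofReal (((Matrix.gram ℝ (T ∘ v)).det / (Matrix.gram ℝ v).det) ^ s)
      ∂(Measure.pi fun _ : Fin n => stdGaussian E) =
    ENNReal.ofReal (∏ j ∈ Finset.range n,
      Real.Gamma (((finrank ℝ F : ℝ) - j) / 2 + s) * Real.Gamma (((finrank ℝ E : ℝ) - j) / 2) /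
      (Real.Gamma (((finrank ℝ E : ℝ) - j) / 2 + s) *
        Real.Gamma (((finrank ℝ F : ℝ) - j) / 2))) := by
  induction n with
  | zero => simp
  | succ n ih =>
    have hmn : ∀ k : ℕ, Measurable fun v : Fin k → E =>
        ENNReal.ofReal (((Matrix.gram ℝ (T ∘ v)).det / (Matrix.gram ℝ v).det) ^ s) := by
      intro k
      have h1 : Measurable fun v : Fin k → E => (Matrix.gram ℝ (T ∘ v)).det :=
        (measurable_det_gram (E := F)).comp (g := Matrix.det ∘ Matrix.gram ℝ)
          (f := fun v : Fin k → E => T ∘ v)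
          (measurable_pi_lambda _ fun i => T.measurable.comp (measurable_pi_apply i))
      exact ((h1.div measurable_det_gram).pow_const s).ennreal_ofReal
    -- Lower integrals permit integrating the new column first with no integrability to check; its
    -- factor will depend on `v` only through dimensions.
    rw [lintegral_pi_stdGaussian_succ (hmn _), Finset.prod_range_succ,
      ENNReal.ofReal_mul, ← ih (by omega), ← lintegral_mul_const _ (hmn _)]
    · refine lintegral_congr_ae ?_
      have hmap : (Measure.pi fun _ : Fin n => stdGaussian E).map (fun v i => T (v i)) =
          Measure.pi fun _ : Fin n => stdGaussian F := by
        have : ∀ i : Fin n, SigmaFinite ((stdGaussian E).map T) := fun i => by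
          rw [stdGaussian_map_of_norm_adjoint T hT]; infer_instance
        rw [Measure.pi_map_pi (fun i => by fun_prop)]
        simp_rw [stdGaussian_map_of_norm_adjoint T hT]
      have hae := ae_det_gram_ne_zero (E := F) (n := n) (by omega)
      have hTm : Measurable fun (v : Fin n → E) i => T (v i) :=
        measurable_pi_lambda _ fun i => T.measurable.comp (measurable_pi_apply i)
      rw [← hmap] at hae
      filter_upwards [ae_of_ae_map hTm.aemeasurable hae] with v hv
      have hv' : (Matrix.gram ℝ (T ∘ v)).det ≠ 0 := hv
      have hli' := Matrix.linearIndependent_of_det_gram_ne_zero hv'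
      have hli : LinearIndependent ℝ v := hli'.of_comp T.toLinearMap
      set K := Submodule.span ℝ (Set.range v) with hK
      set K' := Submodule.span ℝ (Set.range (T ∘ v)) with hK'
      have hKn : finrank ℝ K = n := by rw [finrank_span_eq_card hli, Fintype.card_fin]
      have hKn' : finrank ℝ K' = n := by rw [finrank_span_eq_card hli', Fintype.card_fin]
      have hTK : ∀ x ∈ K, T x ∈ K' := by
        intro x hx
        have : K' = K.map T.toLinearMap := by
          rw [hK, hK', Submodule.map_span, ← Set.range_comp]; rfl
        rw [this]
        exact Submodule.mem_map_of_mem hx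
      have hFE := finrank_le_of_norm_adjoint hT
      have e1 : finrank ℝ K + finrank ℝ Kᗮ = finrank ℝ E := K.finrank_add_finrank_orthogonal
      have e2 : finrank ℝ K' + finrank ℝ K'ᗮ = finrank ℝ F := K'.finrank_add_finrank_orthogonal
      have : Nontrivial Kᗮ := nontrivial_of_finrank_pos (R := ℝ) (by omega)
      have : Nontrivial K'ᗮ := nontrivial_of_finrank_pos (R := ℝ) (by omega)
      -- The compression of `T` to the complements is again a co-isometry, because the adjoint of
      -- `T` maps `K'ᗮ` into `Kᗮ`. The new factor is then a beta ratio in dimensions reduced by `n`.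
      let S : Kᗮ →L[ℝ] K'ᗮ := K'ᗮ.orthogonalProjectionOnto ∘L T ∘L Kᗮ.subtypeL
      have hS : ∀ y, ‖ContinuousLinearMap.adjoint S y‖ = ‖y‖ := by
        intro y
        have hy : ContinuousLinearMap.adjoint T (y : F) ∈ Kᗮ := by
          rw [Submodule.mem_orthogonal]
          intro u hu
          rw [ContinuousLinearMap.adjoint_inner_right]
          exact (Submodule.mem_orthogonal _ _).1 y.2 _ (hTK u hu)
        have : ContinuousLinearMap.adjoint S y = ⟨_, hy⟩ := by
          simp only [S, ContinuousLinearMap.adjoint_comp, Submodule.adjoint_subtypeL,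
            Submodule.adjoint_orthogonalProjectionOnto, ContinuousLinearMap.comp_apply]
          exact Submodule.orthogonalProjectionOnto_mem_subspace_eq_self (⟨_, hy⟩ : Kᗮ)
        rw [this, Submodule.coe_norm, hT, Submodule.coe_norm]
      have hSQ : ∀ x, K'ᗮ.orthogonalProjectionOnto (T x) = S (Kᗮ.orthogonalProjectionOnto x) := by
        intro x
        have hx : x - Kᗮ.orthogonalProjectionOnto x ∈ K := by
          have h := Submodule.sub_starProjection_mem_orthogonal (K := Kᗮ) x
          rwa [Submodule.orthogonal_orthogonal] at h
        have h2 : K'ᗮ.orthogonalProjectionOnto (T (x - Kᗮ.orthogonalProjectionOnto x)) = 0 := by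
          rw [Submodule.orthogonalProjectionOnto_eq_zero_iff, Submodule.orthogonal_orthogonal]
          exact hTK _ hx
        rw [map_sub, map_sub, sub_eq_zero] at h2
        exact h2
      have hratio : ∀ x, ((Matrix.gram ℝ (T ∘ (Fin.cons x v : Fin (n + 1) → E))).det /
          (Matrix.gram ℝ (Fin.cons x v : Fin (n + 1) → E)).det) ^ s =
          ((Matrix.gram ℝ (T ∘ v)).det / (Matrix.gram ℝ v).det) ^ s *
          (‖S (Kᗮ.orthogonalProjectionOnto x)‖ ^ 2 / ‖Kᗮ.orthogonalProjectionOnto x‖ ^ 2) ^ s := by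
        intro x
        have hc : T ∘ (Fin.cons x v : Fin (n + 1) → E) = Fin.cons (T x) (T ∘ v) :=
          Fin.comp_cons _ _ _
        rw [hc, det_gram_cons, det_gram_cons, ← hSQ, mul_div_mul_comm, mul_comm,
          Real.mul_rpow (div_nonneg (det_gram_nonneg _) (det_gram_nonneg _)) (by positivity)]
      simp_rw [hratio]
      have hp : 0 ≤ ((Matrix.gram ℝ (T ∘ v)).det / (Matrix.gram ℝ v).det) ^ s :=
        Real.rpow_nonneg (div_nonneg (det_gram_nonneg _) (det_gram_nonneg _)) _
      simp_rw [ENNReal.ofReal_mul hp]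
      rw [lintegral_const_mul _ (Measurable.ennreal_ofReal (by fun_prop))]
      congr 1
      have hmS : Measurable fun y : Kᗮ => (‖S y‖ ^ 2 / ‖y‖ ^ 2) ^ s := by fun_prop
      have hl := lintegral_map (μ := stdGaussian E) (g := Kᗮ.orthogonalProjectionOnto)
        hmS.ennreal_ofReal (by fun_prop)
      rw [← hl, stdGaussian_map_orthogonalProjection, ← ofReal_integral_eq_lintegral_ofReal,
        integral_norm_ratio_rpow_stdGaussian S hS hs]
      · rw [← e1, ← e2, hKn, hKn']
        simp
      · refine Integrable.of_bound hmS.aestronglyMeasurable 1 (.of_forall fun y => ?_)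
        rw [Real.norm_of_nonneg (by positivity)]
        refine Real.rpow_le_one (by positivity) (div_le_one_of_le₀ ?_ (by positivity)) hs
        gcongr
        exact norm_le_of_norm_adjoint hS y
      · exact .of_forall fun y => by positivity
    · refine Finset.prod_nonneg fun j hj => ?_
      have hFE := finrank_le_of_norm_adjoint hT
      have h1 : (j : ℝ) < finrank ℝ F := by
        have := Finset.mem_range.1 hj
        exact_mod_cast (by omega : j < finrank ℝ F)
      have h2 : (finrank ℝ F : ℝ) ≤ finrank ℝ E := by exact_mod_cast hFE
      have g1 := Real.Gamma_pos_of_pos (show 0 < ((finrank ℝ F : ℝ) - j) / 2 by linarith)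
      have g2 := Real.Gamma_pos_of_pos (show 0 < ((finrank ℝ E : ℝ) - j) / 2 by linarith)
      have g3 := Real.Gamma_pos_of_pos (show 0 < ((finrank ℝ F : ℝ) - j) / 2 + s by linarith)
      have g4 := Real.Gamma_pos_of_pos (show 0 < ((finrank ℝ E : ℝ) - j) / 2 + s by linarith)
      positivity

end GramDeterminant
-- The projection onto the column space, and AM-GM for `tr A³`.
section HatMatrix

open Matrix

variable {m n : Type*} [Fintype m] [Fintype n] [DecidableEq n]

/-- The orthogonal projection onto the column space of a matrix of full column rank. -/
noncomputable def hatMatrix (X : Matrix m n ℝ) : Matrix m m ℝ := X * (Xᵀ * X)⁻¹ * Xᵀ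

lemma hatMatrix_transpose (X : Matrix m n ℝ) : (hatMatrix X)ᵀ = hatMatrix X := by
  simp [hatMatrix, transpose_nonsing_inv, Matrix.mul_assoc]

/-- When the Gram matrix is singular its inverse is `0` by convention, so no rank hypothesis is
needed. -/
lemma hatMatrix_mul_self (X : Matrix m n ℝ) : hatMatrix X * hatMatrix X = hatMatrix X := by
  unfold hatMatrix
  have h : (Xᵀ * X)⁻¹ * (Xᵀ * X) * (Xᵀ * X)⁻¹ = (Xᵀ * X)⁻¹ := by
    by_cases hd : IsUnit (Xᵀ * X).det
    · rw [nonsing_inv_mul _ hd, Matrix.one_mul]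
    · simp [nonsing_inv_apply_not_isUnit _ hd]
  calc X * (Xᵀ * X)⁻¹ * Xᵀ * (X * (Xᵀ * X)⁻¹ * Xᵀ)
      = X * ((Xᵀ * X)⁻¹ * (Xᵀ * X) * (Xᵀ * X)⁻¹) * Xᵀ := by simp only [Matrix.mul_assoc]
    _ = _ := by rw [h]

/-- The column space ignores scale; this removes the variance `1/M`. -/
lemma hatMatrix_smul (X : Matrix m n ℝ) {c : ℝ} (hc : c ≠ 0) :
    hatMatrix (c • X) = hatMatrix X := by
  have h : (Xᵀ * X).det = 0 ∨ IsUnit (Xᵀ * X).det := by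
    rw [isUnit_iff_ne_zero]; exact eq_or_ne _ _
  unfold hatMatrix
  have hW : (c • X)ᵀ * (c • X) = (c * c) • (Xᵀ * X) := by
    rw [transpose_smul, Matrix.smul_mul, Matrix.mul_smul, smul_smul]
  rw [hW, transpose_smul]
  rcases h with h | h
  · rw [nonsing_inv_apply_not_isUnit (Xᵀ * X) (by simp [h]),
      nonsing_inv_apply_not_isUnit _ (by simp [h])]
    simp
  · have : ((c * c) • (Xᵀ * X))⁻¹ = (c * c)⁻¹ • (Xᵀ * X)⁻¹ := by
      apply inv_eq_left_inv
      rw [Matrix.smul_mul, Matrix.mul_smul, smul_smul, nonsing_inv_mul _ h, inv_mul_cancel₀ (by positivity),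
        one_smul]
    rw [this]
    simp only [Matrix.smul_mul, Matrix.mul_smul, smul_smul]
    rw [show c * ((c * c)⁻¹ * c) = 1 by field_simp, one_smul]

lemma hatMatrix_orthogonal_mul [DecidableEq m] (X : Matrix m n ℝ) {O : Matrix m m ℝ}
    (hO : Oᵀ * O = 1) : hatMatrix (O * X) = O * hatMatrix X * Oᵀ := by
  unfold hatMatrix
  have : (O * X)ᵀ * (O * X) = Xᵀ * X := by
    rw [transpose_mul, Matrix.mul_assoc, ← Matrix.mul_assoc Oᵀ, hO, Matrix.one_mul]
  rw [this, transpose_mul]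
  simp only [Matrix.mul_assoc]

lemma trace_hatMatrix (X : Matrix m n ℝ) (hX : (Xᵀ * X).det ≠ 0) :
    (hatMatrix X).trace = Fintype.card n := by
  unfold hatMatrix
  rw [Matrix.mul_assoc, trace_mul_comm, Matrix.mul_assoc,
    nonsing_inv_mul _ (isUnit_iff_ne_zero.2 hX), trace_one]

/-- Symmetry and the value of `S * S` are all that is ever used of the inverse square root. The
eigenvalues are positive, so `x ^ (-1/2)` is continuous on the spectrum and the functional calculus
is multiplicative. -/
lemma exists_orthonormalize_eq_mul (X : Matrix m n ℝ) (hX : (Xᵀ * X).det ≠ 0) :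
    ∃ S : Matrix n n ℝ, Sᵀ = S ∧ S * S = (Xᵀ * X)⁻¹ ∧ orthonormalize X = X * S := by
  have hpsd : (Xᵀ * X).PosSemidef := by
    simpa using posSemidef_conjTranspose_mul_self X
  have hpd : (Xᵀ * X).PosDef := hpsd.posDef_iff_det_ne_zero.2 hX
  have hsa : IsSelfAdjoint (Xᵀ * X) := hpd.isHermitian
  set f : ℝ → ℝ := fun x => x ^ (-(1 / 2) : ℝ) with hf
  have hpos : ∀ x ∈ spectrum ℝ (Xᵀ * X), 0 < x := by
    intro x hx
    rw [hpd.isHermitian.spectrum_real_eq_range_eigenvalues] at hx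
    obtain ⟨i, rfl⟩ := hx
    exact hpd.eigenvalues_pos i
  have hc : ContinuousOn f (spectrum ℝ (Xᵀ * X)) := fun x hx =>
    (Real.continuousAt_rpow_const _ _ (Or.inl (hpos x hx).ne')).continuousWithinAt
  refine ⟨cfc f (Xᵀ * X), ?_, ?_, rfl⟩
  · have : IsSelfAdjoint (cfc f (Xᵀ * X)) := cfc_predicate f _
    rw [← conjTranspose_eq_transpose_of_trivial, ← star_eq_conjTranspose]
    exact this.star_eq
  · symm
    apply inv_eq_left_inv
    have hid : Xᵀ * X = cfc (fun x : ℝ => x) (Xᵀ * X) := (cfc_id' ℝ (Xᵀ * X)).symm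
    nth_rw 3 [hid]
    rw [← cfc_mul f f _ hc hc, ← cfc_mul (fun x => f x * f x) (fun x => x) _ (hc.mul hc) continuousOn_id,
      ← cfc_one ℝ (Xᵀ * X)]
    refine cfc_congr fun x hx => ?_
    have hx := hpos x hx
    simp only [hf, Pi.one_apply]
    rw [← Real.rpow_add hx, show (-(1 / 2) + -(1 / 2) : ℝ) = -1 by norm_num, Real.rpow_neg_one,
      inv_mul_cancel₀ hx.ne']

lemma orthonormalize_mul_transpose (X : Matrix m n ℝ) (hX : (Xᵀ * X).det ≠ 0) :
    orthonormalize X * (orthonormalize X)ᵀ = hatMatrix X := by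
  obtain ⟨S, hS, hSS, h⟩ := exists_orthonormalize_eq_mul X hX
  rw [h, transpose_mul, hS, hatMatrix, ← hSS]
  simp only [Matrix.mul_assoc]

/-- The arithmetic-geometric mean inequality for the eigenvalues of `A ^ 3`. -/
lemma card_mul_det_rpow_le_trace_mul_mul [Nonempty n] {A : Matrix n n ℝ} (hA : A.PosSemidef) :
    (Fintype.card n : ℝ) * A.det ^ (3 / (Fintype.card n : ℝ)) ≤ (A * A * A).trace := by
  have hr : (0 : ℝ) < Fintype.card n := by exact_mod_cast Fintype.card_pos
  have hev := fun i => hA.eigenvalues_nonneg i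
  have htr : (A * A * A).trace = ∑ i, hA.isHermitian.eigenvalues i ^ 3 := by
    have h := hA.isHermitian.spectral_theorem
    set V : Matrix n n ℝ := (hA.isHermitian.eigenvectorUnitary : Matrix n n ℝ)
    set D : Matrix n n ℝ := diagonal (RCLike.ofReal ∘ hA.isHermitian.eigenvalues)
    have hV : star V * V = 1 := Unitary.coe_star_mul_self hA.isHermitian.eigenvectorUnitary
    have h' : A = V * D * star V := h
    have : A * A * A = V * (D * D * D) * star V := by
      rw [h']
      calc V * D * star V * (V * D * star V) * (V * D * star V)
          = V * D * (star V * V) * D * (star V * V) * D * star V := by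
            simp only [Matrix.mul_assoc]
        _ = _ := by rw [hV]; simp only [Matrix.mul_one, Matrix.mul_assoc]
    rw [this, trace_mul_comm, ← Matrix.mul_assoc, hV, Matrix.one_mul]
    simp [D, trace, pow_succ]
  have hdet : A.det = ∏ i, hA.isHermitian.eigenvalues i := by
    rw [hA.isHermitian.det_eq_prod_eigenvalues]; simp
  have amgm := Real.geom_mean_le_arith_mean_weighted Finset.univ
    (fun _ : n => 1 / (Fintype.card n : ℝ)) (fun i => hA.isHermitian.eigenvalues i ^ 3)
    (fun _ _ => by positivity) (by simp [hr.ne']) (fun i _ => pow_nonneg (hev i) 3)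
  rw [Real.finsetProd_rpow _ _ (fun i _ => pow_nonneg (hev i) 3), Finset.prod_pow, ← hdet,
    ← Real.rpow_natCast, ← Real.rpow_mul hA.det_nonneg, ← Finset.mul_sum, ← htr] at amgm
  have e : ((3 : ℕ) : ℝ) * (1 / (Fintype.card n : ℝ)) = 3 / Fintype.card n := by
    push_cast; ring
  rw [e] at amgm
  calc _ ≤ (Fintype.card n : ℝ) * (1 / (Fintype.card n : ℝ) * (A * A * A).trace) := by gcongr
    _ = _ := by field_simp

end HatMatrix

/-! ### Algebra of `term₁` and `σ_η²` in terms of `U Uᵀ`. -/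

section Shuffle

open Matrix

variable {M₁ M₂ r : ℕ}

/-- The lower block of `X S` is that of `X` times `S`, and `det S ^ 2` is the inverse of `det (Xᵀ
X)`. -/
lemma det_gram₂_orthonormalize (X : Matrix (Fin M₁ ⊕ Fin M₂) (Fin r) ℝ)
    (hX : (Xᵀ * X).det ≠ 0) :
    (gram₂ (orthonormalize X)).det = (X.toRows₂ᵀ * X.toRows₂).det / (Xᵀ * X).det := by
  obtain ⟨S, hS, hSS, h⟩ := exists_orthonormalize_eq_mul X hX
  have h2 : (X * S).toRows₂ = X.toRows₂ * S := rfl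
  have hd : S.det * S.det = ((Xᵀ * X).det)⁻¹ := by
    rw [← det_mul, hSS, det_nonsing_inv, Ring.inverse_eq_inv']
  rw [gram₂, h, h2, transpose_mul, hS, Matrix.mul_assoc, det_mul, ← Matrix.mul_assoc, det_mul,
    div_eq_mul_inv, ← hd]
  ring

/-- The entries of `τ τᵀ`, in terms of `H = U Uᵀ`. -/
def diffEntry (φ : Equiv.Perm (Fin M₂)) (H : Matrix (Fin M₁ ⊕ Fin M₂) (Fin M₁ ⊕ Fin M₂) ℝ)
    (i j : Fin M₂) : ℝ :=
  H (.inr i) (.inr j) - H (.inr (φ i)) (.inr j) - H (.inr i) (.inr (φ j)) +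
    H (.inr (φ i)) (.inr (φ j))

lemma one_sub_permMatrix_mul_apply {m n : Type*} [Fintype m] [DecidableEq m]
    (σ : Equiv.Perm m) (A : Matrix m n ℝ) (i : m) (k : n) :
    ((1 - σ.permMatrix ℝ : Matrix m m ℝ) * A : Matrix m n ℝ) i k = A i k - A (σ i) k := by
  rw [Matrix.sub_mul, Matrix.one_mul, Matrix.sub_apply, Equiv.Perm.permMatrix,
    PEquiv.toMatrix_toPEquiv_mul]
  rfl

lemma term₁_eq (φ : Equiv.Perm (Fin M₂)) (m : Fin M₂)
    (U : Matrix (Fin M₁ ⊕ Fin M₂) (Fin r) ℝ) :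
    term₁ φ m U = ∑ i, ∑ j, (U * Uᵀ) (.inr i) (.inr m) * diffEntry φ (U * Uᵀ) i j *
      (U * Uᵀ) (.inr j) (.inr m) := by
  have hα : ∀ i, alphaVec U m i = (U * Uᵀ) (.inr i) (.inr m) := fun i => rfl
  have hτ : ∀ i j, (tau₂ φ U * (tau₂ φ U)ᵀ) i j = diffEntry φ (U * Uᵀ) i j := by
    intro i j
    have ht : ∀ i k, tau₂ φ U i k = U (.inr i) k - U (.inr (φ i)) k := fun i k =>
      one_sub_permMatrix_mul_apply φ U.toRows₂ i k
    simp only [mul_apply, transpose_apply, ht, diffEntry, ← Finset.sum_sub_distrib, ← Finset.sum_add_distrib]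
    exact Finset.sum_congr rfl fun k _ => by ring
  simp only [term₁, dotProduct, mulVec, hα, hτ, Finset.mul_sum, mul_assoc]

lemma sum_sub_single_mul_sum_mul {ι : Type*} [Fintype ι] [DecidableEq ι] (p : ι → ℝ)
    (D : ι → ι → ℝ) (hD : ∀ i j, D i j = D j i) (m : ι) :
    ∑ i, (p i - if i = m then 1 else 0) * ∑ j, D i j * (p j - if j = m then 1 else 0) =
      ∑ i, ∑ j, p i * D i j * p j - 2 * ∑ i, p i * D i m + D m m := by
  have h1 : ∀ i, ∑ j, D i j * (p j - if j = m then 1 else 0) = ∑ j, D i j * p j - D i m := by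
    intro i; simp [mul_sub, Finset.sum_sub_distrib]
  have h2 : ∑ j, D m j * p j = ∑ i, p i * D i m :=
    Finset.sum_congr rfl fun j _ => by rw [hD, mul_comm]
  have h3 : ∀ i, (p i - if i = m then 1 else 0) * (∑ j, D i j * p j - D i m) =
      ∑ j, p i * D i j * p j - p i * D i m - if i = m then ∑ j, D i j * p j - D i m else 0 := by
    intro i
    rw [sub_mul, mul_sub, Finset.mul_sum]
    simp [mul_assoc]
  simp only [h1, h3, Finset.sum_sub_distrib, Finset.sum_ite_eq', Finset.mem_univ, if_true, h2]
  ring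

lemma sigmaEtaSq_eq (φ : Equiv.Perm (Fin M₂)) (m : Fin M₂)
    (U : Matrix (Fin M₁ ⊕ Fin M₂) (Fin r) ℝ) :
    sigmaEtaSq φ m U = 1 / (r : ℝ) * (term₁ φ m U -
      2 * ∑ i, (U * Uᵀ) (.inr i) (.inr m) * diffEntry φ (U * Uᵀ) i m +
        diffEntry φ (U * Uᵀ) m m) := by
  have hκ : ∀ i, kappaVec U m (.inr i) = (U * Uᵀ) (.inr i) (.inr m) - if i = m then 1 else 0 := by
    intro i
    simp only [kappaVec, Pi.sub_apply, Pi.single_apply, Sum.inr.injEq]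
    rfl
  -- Indices fixed by the permutation give zero rows of `τ`, so only the shuffled block contributes.
  have hl : ∀ i k, tauFull φ U (.inl i) k = 0 := fun i k =>
    (one_sub_permMatrix_mul_apply _ U _ k).trans (by simp)
  have hr : ∀ i k, tauFull φ U (.inr i) k = U (.inr i) k - U (.inr (φ i)) k := fun i k =>
    (one_sub_permMatrix_mul_apply _ U _ k).trans (by simp)
  have hτ : ∀ i j, (tauFull φ U * (tauFull φ U)ᵀ) (.inr i) (.inr j) =
      diffEntry φ (U * Uᵀ) i j := by
    intro i j
    simp only [mul_apply, transpose_apply, hr, diffEntry,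
      ← Finset.sum_sub_distrib, ← Finset.sum_add_distrib]
    exact Finset.sum_congr rfl fun k _ => by ring
  have hτl : ∀ i j, (tauFull φ U * (tauFull φ U)ᵀ) (.inl i) j = 0 := by
    intro i j; simp [mul_apply, hl]
  have hτr : ∀ i j, (tauFull φ U * (tauFull φ U)ᵀ) i (.inl j) = 0 := by
    intro i j; simp [mul_apply, hl]
  have hsymm : ∀ i j, diffEntry φ (U * Uᵀ) i j = diffEntry φ (U * Uᵀ) j i := by
    intro i j; rw [← hτ, ← hτ, ← transpose_apply (_ * _), transpose_mul, transpose_transpose]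
  rw [term₁_eq, sigmaEtaSq]
  congr 1
  simp only [dotProduct, mulVec, Fintype.sum_sum_type, hτ, hτl, hτr, hκ]
  simp only [zero_mul, mul_zero, Finset.sum_const_zero, zero_add]
  exact sum_sub_single_mul_sum_mul _ _ hsymm m

end Shuffle
-- Moments of a rotation-invariant random projection.
section InvariantProjection

open Matrix

variable {Ω ι : Type*} [MeasurableSpace Ω] [Fintype ι] [DecidableEq ι]

/-- A random orthogonal projection matrix of rank `r` whose law is invariant under orthogonal
conjugation. -/
structure IsInvariantProjection (H : Ω → Matrix ι ι ℝ) (r : ℕ) (P : Measure Ω) : Prop where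
  measurable : ∀ i j, Measurable fun ω => H ω i j
  transpose_eq : ∀ ω, (H ω)ᵀ = H ω
  mul_self : ∀ ω, H ω * H ω = H ω
  trace_eq : ∀ᵐ ω ∂P, (H ω).trace = r
  invariant : ∀ O : Matrix ι ι ℝ, Oᵀ * O = 1 → ∀ f : Matrix ι ι ℝ → ℝ, Continuous f →
    ∫ ω, f (H ω) ∂P = ∫ ω, f (O * H ω * Oᵀ) ∂P

namespace IsInvariantProjection

variable {H : Ω → Matrix ι ι ℝ} {r : ℕ} {P : Measure Ω}

lemma symm_apply (h : IsInvariantProjection H r P) (ω : Ω) (i j : ι) : H ω i j = H ω j i := by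
  rw [← transpose_apply (H ω), h.transpose_eq]

lemma sum_sq (h : IsInvariantProjection H r P) (ω : Ω) (i : ι) :
    ∑ j, H ω i j ^ 2 = H ω i i := by
  nth_rw 2 [← h.mul_self ω]
  rw [mul_apply]
  exact Finset.sum_congr rfl fun j _ => by rw [h.symm_apply ω j i, sq]

/-- From the row identity, `H_ij² ≤ H_ii`; taking `j = i` gives `H_ii ≤ 1`. -/
lemma apply_mem_Icc (h : IsInvariantProjection H r P) (ω : Ω) (i j : ι) :
    H ω i j ∈ Set.Icc (-1 : ℝ) 1 := by
  have h1 : ∀ j, H ω i j ^ 2 ≤ H ω i i := fun j => by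
    rw [← h.sum_sq ω i]
    exact Finset.single_le_sum (f := fun j => H ω i j ^ 2) (fun _ _ => sq_nonneg _)
      (Finset.mem_univ j)
  have h2 : H ω i i ≤ 1 := by nlinarith [h1 i]
  exact abs_le.1 (abs_le_one_iff_mul_self_le_one.2 (by nlinarith [h1 j]))

/-- The entries stay in a compact cube, on which a continuous `f` is bounded. -/
lemma integrable [IsFiniteMeasure P] (h : IsInvariantProjection H r P) {f : Matrix ι ι ℝ → ℝ}
    (hf : Continuous f) : Integrable (fun ω => f (H ω)) P := by
  have hK : IsCompact (Set.univ.pi fun _ : ι => Set.univ.pi fun _ : ι => Set.Icc (-1 : ℝ) 1) :=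
    isCompact_univ_pi fun _ => isCompact_univ_pi fun _ => isCompact_Icc
  obtain ⟨C, hC⟩ := hK.exists_bound_of_continuousOn (f := f) hf.continuousOn
  have key : ∀ g : (ι → ι → ℝ) → ℝ, Continuous g → Measurable g := fun g hg => hg.measurable
  have hm : Measurable fun ω => f (H ω) :=
    (key f hf).comp
      (measurable_pi_lambda _ fun i => measurable_pi_lambda _ fun j => h.measurable i j)
  exact Integrable.of_bound hm.aestronglyMeasurable C (.of_forall fun ω =>
    hC _ fun i _ j _ => h.apply_mem_Icc ω i j)

lemma integral_submatrix (h : IsInvariantProjection H r P) (σ : Equiv.Perm ι)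
    {f : Matrix ι ι ℝ → ℝ} (hf : Continuous f) :
    ∫ ω, f (H ω) ∂P = ∫ ω, f ((H ω).submatrix σ σ) ∂P := by
  have e : ∀ M : Matrix ι ι ℝ, σ.permMatrix ℝ * M * (σ.permMatrix ℝ)ᵀ = M.submatrix σ σ := by
    intro M
    rw [transpose_permMatrix, Equiv.Perm.permMatrix, Equiv.Perm.permMatrix,
      PEquiv.toMatrix_toPEquiv_mul, PEquiv.mul_toMatrix_toPEquiv]
    rfl
  have ho : (σ.permMatrix ℝ)ᵀ * σ.permMatrix ℝ = 1 := by
    rw [transpose_permMatrix, ← permMatrix_mul]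
    simp
  rw [h.invariant _ ho f hf]
  simp_rw [e]

/-- The sign change of the coordinate `k`. -/
def flipSign (k i : ι) : ℝ := if i = k then -1 else 1

omit [Fintype ι] in
lemma flipSign_self (k : ι) : flipSign k k = -1 := if_pos rfl

omit [Fintype ι] in
lemma flipSign_of_ne {k i : ι} (h : i ≠ k) : flipSign k i = 1 := if_neg h

omit [Fintype ι] in
lemma flipSign_mul_self (k i : ι) : flipSign k i * flipSign k i = 1 := by
  unfold flipSign; split_ifs <;> norm_num

/-- Conjugation by a diagonal sign matrix preserves the law, so the integral equals its own
negative. -/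
lemma integral_eq_zero_of_flipSign (h : IsInvariantProjection H r P) (k : ι)
    {f : Matrix ι ι ℝ → ℝ} (hf : Continuous f)
    (hk : ∀ M : Matrix ι ι ℝ, f (of fun i j => flipSign k i * M i j * flipSign k j) = -f M) :
    ∫ ω, f (H ω) ∂P = 0 := by
  have ho : (diagonal (flipSign k))ᵀ * diagonal (flipSign k) = (1 : Matrix ι ι ℝ) := by
    rw [diagonal_transpose, diagonal_mul_diagonal]
    simp_rw [flipSign_mul_self, diagonal_one]
  have e : ∀ M : Matrix ι ι ℝ, diagonal (flipSign k) * M * (diagonal (flipSign k))ᵀ =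
      of fun i j => flipSign k i * M i j * flipSign k j := by
    intro M; ext i j; simp [diagonal_transpose]
  have h1 := h.invariant _ ho f hf
  simp_rw [e, hk] at h1
  rw [integral_neg] at h1
  linarith

lemma integral_apply_of_ne (h : IsInvariantProjection H r P) {a b : ι} (hab : a ≠ b) :
    ∫ ω, H ω a b ∂P = 0 := by
  refine h.integral_eq_zero_of_flipSign a (f := fun M => M a b) (by fun_prop) fun M => ?_
  simp [flipSign_self, flipSign_of_ne hab.symm]

lemma integral_mul_of_ne (h : IsInvariantProjection H r P) {a b c d : ι} (hb : a ≠ b)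
    (hc : a ≠ c) (hd : a ≠ d) : ∫ ω, H ω a b * H ω c d ∂P = 0 := by
  refine h.integral_eq_zero_of_flipSign a (f := fun M => M a b * M c d) (by fun_prop) fun M => ?_
  simp [flipSign_self, flipSign_of_ne hb.symm, flipSign_of_ne hc.symm, flipSign_of_ne hd.symm]

lemma integral_mul_apply_of_ne (h : IsInvariantProjection H r P) {a b : ι} (hab : a ≠ b) (c : ι) :
    ∫ ω, H ω a c * H ω b c ∂P = 0 := by
  refine h.integral_eq_zero_of_flipSign a (f := fun M => M a c * M b c) (by fun_prop) fun M => ?_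
  simp only [of_apply, flipSign_self, flipSign_of_ne hab.symm]
  linear_combination -M a c * M b c * flipSign_mul_self a c

/-- The signs attached to `c` and `d` occur twice and cancel, even if these indices coincide with
`a` or `b`; a single sign from `a` is left. -/
lemma integral_mul_mul_of_ne (h : IsInvariantProjection H r P) {a b : ι} (hab : a ≠ b)
    (c d : ι) : ∫ ω, H ω a c * H ω b d * H ω d c ∂P = 0 := by
  refine h.integral_eq_zero_of_flipSign a (f := fun M => M a c * M b d * M d c) (by fun_prop)
    fun M => ?_
  simp only [of_apply, flipSign_self, flipSign_of_ne hab.symm]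
  linear_combination -M a c * M b d * M d c * (flipSign a c * flipSign a c * flipSign_mul_self a d
    + flipSign_mul_self a c)

variable [IsProbabilityMeasure P]

lemma integral_diag (h : IsInvariantProjection H r P) (i : ι) :
    ∫ ω, H ω i i ∂P = r / Fintype.card ι := by
  have hc : ∀ j, ∫ ω, H ω j j ∂P = ∫ ω, H ω i i ∂P := by
    intro j
    rw [h.integral_submatrix (Equiv.swap i j) (f := fun M => M j j) (by fun_prop)]
    simp
  have hs : ∑ j, ∫ ω, H ω j j ∂P = r := by
    rw [← integral_finsetSum _ fun j _ => h.integrable (f := fun M => M j j) (by fun_prop),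
      integral_congr_ae (g := fun _ => (r : ℝ)) (f := fun ω => ∑ j, H ω j j)
        (h.trace_eq.mono fun ω hω => hω)]
    simp
  have : Nonempty ι := ⟨i⟩
  simp_rw [hc, Finset.sum_const, nsmul_eq_mul, Finset.card_univ] at hs
  rw [← hs]
  field_simp

omit [IsProbabilityMeasure P] in
lemma integral_sq_swap (h : IsInvariantProjection H r P) {i j k : ι} (hj : i ≠ j) (hk : i ≠ k) :
    ∫ ω, H ω i k ^ 2 ∂P = ∫ ω, H ω i j ^ 2 ∂P := by
  rw [h.integral_submatrix (Equiv.swap j k) (f := fun M => M i k ^ 2) (by fun_prop)]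
  simp [Equiv.swap_apply_of_ne_of_ne hj hk]

omit [IsProbabilityMeasure P] in
lemma integral_diag_mul_diag_swap (h : IsInvariantProjection H r P) {i j k : ι} (hj : i ≠ j)
    (hk : i ≠ k) : ∫ ω, H ω i i * H ω k k ∂P = ∫ ω, H ω i i * H ω j j ∂P := by
  rw [h.integral_submatrix (Equiv.swap j k) (f := fun M => M i i * M k k) (by fun_prop)]
  simp [Equiv.swap_apply_of_ne_of_ne hj hk]

/-- Expectation of the row identity `∑ H_ik² = H_ii`, with equal off-diagonal terms. -/
lemma integral_sq_diag_add (h : IsInvariantProjection H r P) {i j : ι} (hij : i ≠ j) :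
    ∫ ω, H ω i i ^ 2 ∂P + (Fintype.card ι - 1) * ∫ ω, H ω i j ^ 2 ∂P = r / Fintype.card ι := by
  have h1 : ∑ k, ∫ ω, H ω i k ^ 2 ∂P = r / Fintype.card ι := by
    rw [← integral_finsetSum _ fun k _ => h.integrable (f := fun M => M i k ^ 2) (by fun_prop)]
    simp_rw [h.sum_sq, h.integral_diag]
  rw [← Finset.add_sum_erase _ _ (Finset.mem_univ i), Finset.sum_congr rfl fun k hk =>
    h.integral_sq_swap hij (Finset.ne_of_mem_erase hk).symm] at h1
  rw [← h1, Finset.sum_const, Finset.card_erase_of_mem (Finset.mem_univ i), nsmul_eq_mul,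
    Finset.card_univ, Nat.cast_sub (Fintype.card_pos_iff.2 ⟨i⟩), Nat.cast_one]

/-- Expectation of `H_ii · tr H = r H_ii`, with equal terms for `k ≠ i`. -/
lemma integral_sq_diag_add_diag (h : IsInvariantProjection H r P) {i j : ι} (hij : i ≠ j) :
    ∫ ω, H ω i i ^ 2 ∂P + (Fintype.card ι - 1) * ∫ ω, H ω i i * H ω j j ∂P =
      r * (r / Fintype.card ι) := by
  have h1 : ∑ k, ∫ ω, H ω i i * H ω k k ∂P = r * (r / Fintype.card ι) := by
    rw [← integral_finsetSum _ fun k _ =>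
      h.integrable (f := fun M => M i i * M k k) (by fun_prop), ← h.integral_diag i,
      ← integral_const_mul]
    refine integral_congr_ae (h.trace_eq.mono fun ω hω => ?_)
    simp only
    rw [← Finset.mul_sum, mul_comm, ← hω]
    rfl
  rw [← Finset.add_sum_erase _ _ (Finset.mem_univ i), Finset.sum_congr rfl fun k hk =>
    h.integral_diag_mul_diag_swap hij (Finset.ne_of_mem_erase hk).symm] at h1
  rw [← h1, Finset.sum_const, Finset.card_erase_of_mem (Finset.mem_univ i), nsmul_eq_mul,
    Finset.card_univ, Nat.cast_sub (Fintype.card_pos_iff.2 ⟨i⟩), Nat.cast_one]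
  simp_rw [sq]

/-- A reflection in the plane of two coordinates, with rational entries. -/
noncomputable def planeReflection (i j : ι) : Matrix ι ι ℝ :=
  -- The normal `z = e_i - 2 e_j` has `‖z‖² = 5`, hence the factor `2/5`; row `i` has the entries
  -- `3/5` and `4/5`.
  1 - (2 / 5 : ℝ) • vecMulVec (Pi.single i 1 - Pi.single j 2) (Pi.single i 1 - Pi.single j 2)

lemma planeReflection_orthogonal {i j : ι} (hij : i ≠ j) :
    (planeReflection i j)ᵀ * planeReflection i j = (1 : Matrix ι ι ℝ) := by
  set z : ι → ℝ := Pi.single i 1 - Pi.single j 2 with hz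
  have hzz : z ⬝ᵥ z = 5 := by
    simp [hz, hij, hij.symm]
    norm_num
  have h2 : vecMulVec z z * vecMulVec z z = (5 : ℝ) • vecMulVec z z := by
    rw [vecMulVec_mul_vecMulVec, hzz]
    ext a b
    simp only [vecMulVec_apply, Matrix.smul_apply, Pi.smul_apply, smul_eq_mul]
    ring
  rw [planeReflection, ← hz, transpose_sub, transpose_smul, transpose_vecMulVec, transpose_one,
    Matrix.sub_mul, Matrix.one_mul, Matrix.smul_mul, Matrix.mul_sub, Matrix.mul_smul, Matrix.mul_one,
    h2]
  module

lemma planeReflection_conj_apply {i j : ι} (hij : i ≠ j) (M : Matrix ι ι ℝ) :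
    (planeReflection i j * M * (planeReflection i j)ᵀ) i i =
      9 / 25 * M i i + 12 / 25 * (M i j + M j i) + 16 / 25 * M j j := by
  have hrow : ∀ k, planeReflection i j i k =
      (if k = i then 3 / 5 else 0) + (if k = j then (4 / 5 : ℝ) else 0) := by
    intro k
    by_cases h1 : k = i
    · subst h1
      simp [planeReflection, vecMulVec_apply, hij]
      norm_num
    · by_cases h2 : k = j
      · subst h2
        simp [planeReflection, vecMulVec_apply, hij, hij.symm]
        norm_num
      · simp [planeReflection, vecMulVec_apply, hij, h1, h2, Ne.symm h1]
  simp only [mul_apply, transpose_apply, hrow, add_mul, mul_add, ite_mul, mul_ite, zero_mul,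
    mul_zero, Finset.sum_add_distrib, Finset.sum_ite_eq', Finset.mem_univ, if_true]
  ring

/-- Expanding the reflected `H_ii²` leaves `(81 + 256)/625` of the same moment after odd terms
vanish; the remaining `288/625` balances `288/625` of the mixed moment and `576/625` of the
off-diagonal one. -/
lemma integral_sq_diag_eq (h : IsInvariantProjection H r P) {i j : ι} (hij : i ≠ j) :
    ∫ ω, H ω i i ^ 2 ∂P = ∫ ω, H ω i i * H ω j j ∂P + 2 * ∫ ω, H ω i j ^ 2 ∂P := by
  have h1 := h.invariant _ (planeReflection_orthogonal hij) (fun M => M i i ^ 2) (by fun_prop)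
  have hjj : ∫ ω, H ω j j ^ 2 ∂P = ∫ ω, H ω i i ^ 2 ∂P := by
    rw [h.integral_submatrix (Equiv.swap i j) (f := fun M => M j j ^ 2) (by fun_prop)]
    simp
  have z1 : ∫ ω, H ω j i * H ω i i ∂P = 0 := h.integral_mul_of_ne hij.symm hij.symm hij.symm
  have z2 : ∫ ω, H ω i j * H ω j j ∂P = 0 := h.integral_mul_of_ne hij hij hij
  have e : ∀ ω, (planeReflection i j * H ω * (planeReflection i j)ᵀ) i i ^ 2 =
      81 / 625 * H ω i i ^ 2 + 256 / 625 * H ω j j ^ 2 + 576 / 625 * H ω i j ^ 2 +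
        288 / 625 * (H ω i i * H ω j j) + 432 / 625 * (H ω j i * H ω i i) +
          768 / 625 * (H ω i j * H ω j j) := by
    intro ω
    rw [planeReflection_conj_apply hij, h.symm_apply ω j i]
    ring
  simp_rw [e] at h1
  have i1 := h.integrable (f := fun M => 81 / 625 * M i i ^ 2) (by fun_prop)
  have i2 := h.integrable (f := fun M => 256 / 625 * M j j ^ 2) (by fun_prop)
  have i3 := h.integrable (f := fun M => 576 / 625 * M i j ^ 2) (by fun_prop)
  have i4 := h.integrable (f := fun M => 288 / 625 * (M i i * M j j)) (by fun_prop)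
  have i5 := h.integrable (f := fun M => 432 / 625 * (M j i * M i i)) (by fun_prop)
  have i6 := h.integrable (f := fun M => 768 / 625 * (M i j * M j j)) (by fun_prop)
  rw [integral_add ?_ i6, integral_add ?_ i5, integral_add ?_ i4, integral_add ?_ i3,
    integral_add i1 i2] at h1
  · simp only [integral_const_mul, z1, z2, hjj] at h1
    linarith
  · exact i1.add i2
  · exact (i1.add i2).add i3
  · exact ((i1.add i2).add i3).add i4
  · exact (((i1.add i2).add i3).add i4).add i5

end IsInvariantProjection

end InvariantProjection
-- Expectations of the shuffled quadratic forms.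
section ShuffleMoments

open Matrix

namespace IsInvariantProjection

variable {Ω : Type*} [MeasurableSpace Ω] {M₁ M₂ r : ℕ}
  {H : Ω → Matrix (Fin M₁ ⊕ Fin M₂) (Fin M₁ ⊕ Fin M₂) ℝ} {P : Measure Ω}

/-- As `H = H Hᵀ`, the form is a sum of squares; `g` need not be injective. -/
lemma sum_sum_mul_apply_mul_nonneg {Ω ι κ : Type*} [MeasurableSpace Ω] [Fintype ι] [DecidableEq ι]
    [Fintype κ] {H : Ω → Matrix ι ι ℝ} {P : Measure Ω} (h : IsInvariantProjection H r P) (ω : Ω)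
    (g : κ → ι) (w : κ → ℝ) : 0 ≤ ∑ i, ∑ j, w i * H ω (g i) (g j) * w j := by
  have e : ∑ i, ∑ j, w i * H ω (g i) (g j) * w j = ∑ k, (∑ i, w i * H ω (g i) k) ^ 2 := by
    have hg : ∀ a b, H ω a b = ∑ k, H ω a k * H ω b k := by
      intro a b
      nth_rw 1 [← h.mul_self ω]
      rw [mul_apply]
      exact Finset.sum_congr rfl fun k _ => by rw [h.symm_apply ω k b]
    simp_rw [sq, Finset.sum_mul_sum, hg _ (g _), Finset.mul_sum, Finset.sum_mul]
    conv_rhs => rw [Finset.sum_comm]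
    refine Finset.sum_congr rfl fun i _ => ?_
    conv_rhs => rw [Finset.sum_comm]
    refine Finset.sum_congr rfl fun j _ => Finset.sum_congr rfl fun k _ => ?_
    ring
  rw [e]
  positivity

variable [IsProbabilityMeasure P]

lemma integral_trace_cube_le (h : IsInvariantProjection H r P) (φ : Equiv.Perm (Fin M₂))
    (hφ : ∀ i, φ i ≠ i) (m : Fin M₂) :
    1 / (M₂ : ℝ) * ∫ ω, ((H ω).toBlocks₂₂ * (H ω).toBlocks₂₂ * (H ω).toBlocks₂₂).trace ∂P ≤
      ∫ ω, ∑ i, ∑ j, H ω (.inr i) (.inr m) * diffEntry φ (H ω) i j *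
        H ω (.inr j) (.inr m) ∂P := by
  have hM₂ : (M₂ : ℝ) ≠ 0 := by exact_mod_cast (Fin.pos m).ne'
  have hinr : ∀ i, (Sum.inr i : Fin M₁ ⊕ Fin M₂) ≠ .inr (φ i) := fun i hi =>
    hφ i (Sum.inr_injective hi).symm
  set C : Fin M₂ → Matrix (Fin M₁ ⊕ Fin M₂) (Fin M₁ ⊕ Fin M₂) ℝ → ℝ := fun m A =>
    ∑ i, ∑ j, A (.inr i) (.inr m) * A (.inr i) (.inr j) * A (.inr j) (.inr m) with hC
  have hCc : ∀ m, Continuous (C m) := fun m => by fun_prop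
  -- Swapping `m` and `k` in the lower block preserves the law and merely reindexes the two sums.
  have hCm : ∀ k, ∫ ω, C k (H ω) ∂P = ∫ ω, C m (H ω) ∂P := by
    intro k
    rw [h.integral_submatrix (Equiv.Perm.sumCongr 1 (Equiv.swap m k)) (hCc k)]
    refine integral_congr_ae (.of_forall fun ω => ?_)
    simp only [hC, submatrix_apply, Equiv.Perm.sumCongr_apply, Sum.map_inr, Equiv.swap_apply_right]
    rw [Equiv.sum_comp (Equiv.swap m k) (fun i => ∑ j, H ω (.inr i) (.inr m) *
      H ω (.inr i) (.inr (Equiv.swap m k j)) * H ω (.inr (Equiv.swap m k j)) (.inr m))]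
    refine Finset.sum_congr rfl fun i _ => ?_
    exact Equiv.sum_comp (Equiv.swap m k) (fun j => H ω (.inr i) (.inr m) *
      H ω (.inr i) (.inr j) * H ω (.inr j) (.inr m))
  have htr : ∀ ω, ((H ω).toBlocks₂₂ * (H ω).toBlocks₂₂ * (H ω).toBlocks₂₂).trace =
      ∑ k, C k (H ω) := by
    intro ω
    simp only [trace, diag_apply, mul_apply, hC, toBlocks₂₂, of_apply, Finset.sum_mul]
    refine Finset.sum_congr rfl fun k _ => ?_
    rw [Finset.sum_comm]
    refine Finset.sum_congr rfl fun i _ => Finset.sum_congr rfl fun j _ => ?_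
    rw [h.symm_apply ω (.inr k)]
  simp_rw [htr]
  rw [integral_finsetSum _ fun k _ => h.integrable (hCc k)]
  simp_rw [hCm]
  rw [Finset.sum_const, Finset.card_univ, Fintype.card_fin, nsmul_eq_mul, ← mul_assoc,
    one_div_mul_cancel hM₂, one_mul]
  set X : Matrix (Fin M₁ ⊕ Fin M₂) (Fin M₁ ⊕ Fin M₂) ℝ → ℝ := fun A =>
    ∑ i, ∑ j, A (.inr i) (.inr m) * A (.inr (φ i)) (.inr j) * A (.inr j) (.inr m) with hX
  set Z : Matrix (Fin M₁ ⊕ Fin M₂) (Fin M₁ ⊕ Fin M₂) ℝ → ℝ := fun A =>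
    ∑ i, ∑ j, A (.inr i) (.inr m) * A (.inr (φ i)) (.inr (φ j)) * A (.inr j) (.inr m) with hZ
  have hXi : ∫ ω, X (H ω) ∂P = 0 := by
    simp only [hX]
    rw [integral_finsetSum _ fun i _ => h.integrable (f := fun A => ∑ j, A (.inr i) (.inr m) *
      A (.inr (φ i)) (.inr j) * A (.inr j) (.inr m)) (by fun_prop)]
    refine Finset.sum_eq_zero fun i _ => ?_
    rw [integral_finsetSum _ fun j _ => h.integrable (f := fun A => A (.inr i) (.inr m) *
      A (.inr (φ i)) (.inr j) * A (.inr j) (.inr m)) (by fun_prop)]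
    exact Finset.sum_eq_zero fun j _ => h.integral_mul_mul_of_ne (hinr i) _ _
  have hsplit : ∀ ω, ∑ i, ∑ j, H ω (.inr i) (.inr m) * diffEntry φ (H ω) i j *
      H ω (.inr j) (.inr m) = C m (H ω) - 2 * X (H ω) + Z (H ω) := by
    intro ω
    have hX' : X (H ω) = ∑ i, ∑ j, H ω (.inr i) (.inr m) * H ω (.inr i) (.inr (φ j)) *
        H ω (.inr j) (.inr m) := by
      simp only [hX]
      rw [Finset.sum_comm]
      refine Finset.sum_congr rfl fun i _ => Finset.sum_congr rfl fun j _ => ?_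
      rw [h.symm_apply ω (.inr (φ j))]
      ring
    rw [two_mul]
    nth_rw 2 [hX']
    simp only [hC, hX, hZ, ← Finset.sum_sub_distrib, ← Finset.sum_add_distrib, diffEntry]
    refine Finset.sum_congr rfl fun i _ => ?_
    refine Finset.sum_congr rfl fun j _ => ?_
    ring
  simp_rw [hsplit]
  have iC := h.integrable (hCc m)
  have iX := h.integrable (f := fun A => 2 * X A) (by fun_prop)
  have iZ := h.integrable (f := Z) (by fun_prop)
  rw [integral_add ?_ iZ, integral_sub iC iX, integral_const_mul, hXi]
  · have : 0 ≤ ∫ ω, Z (H ω) ∂P := integral_nonneg fun ω => by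
      have := h.sum_sum_mul_apply_mul_nonneg ω (fun i => .inr (φ i)) fun i => H ω (.inr i) (.inr m)
      exact this
    linarith
  · exact iC.sub iX

lemma integral_sum_mul_diffEntry (h : IsInvariantProjection H r P) (φ : Equiv.Perm (Fin M₂))
    (hφ₁ : ∀ i, φ i ≠ i) (hφ₂ : ∀ i, φ (φ i) ≠ i) (m : Fin M₂) :
    ∫ ω, ∑ i, H ω (.inr i) (.inr m) * diffEntry φ (H ω) i m ∂P =
      ∫ ω, H ω (.inr m) (.inr m) ^ 2 ∂P + (M₂ - 1) * ∫ ω, H ω (.inr m) (.inr (φ m)) ^ 2 ∂P +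
        ∫ ω, H ω (.inr m) (.inr m) * H ω (.inr (φ m)) (.inr (φ m)) ∂P := by
  have hinr : ∀ {i j}, i ≠ j → (Sum.inr i : Fin M₁ ⊕ Fin M₂) ≠ .inr j := fun hij hi =>
    hij (Sum.inr_injective hi)
  have hterm : ∀ i, ∫ ω, H ω (.inr i) (.inr m) * diffEntry φ (H ω) i m ∂P =
      ∫ ω, H ω (.inr m) (.inr i) ^ 2 ∂P +
        ∫ ω, H ω (.inr i) (.inr m) * H ω (.inr (φ i)) (.inr (φ m)) ∂P := by
    intro i
    have e : ∀ ω, H ω (.inr i) (.inr m) * diffEntry φ (H ω) i m =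
        H ω (.inr m) (.inr i) ^ 2 - H ω (.inr i) (.inr m) * H ω (.inr (φ i)) (.inr m) -
          H ω (.inr m) (.inr i) * H ω (.inr (φ m)) (.inr i) +
            H ω (.inr i) (.inr m) * H ω (.inr (φ i)) (.inr (φ m)) := by
      intro ω
      rw [diffEntry, h.symm_apply ω (.inr m) (.inr i), h.symm_apply ω (.inr (φ m)) (.inr i)]
      ring
    simp_rw [e]
    have i1 := h.integrable (f := fun A => A (.inr m) (.inr i) ^ 2) (by fun_prop)
    have i2 := h.integrable (f := fun A => A (.inr i) (.inr m) * A (.inr (φ i)) (.inr m))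
      (by fun_prop)
    have i3 := h.integrable (f := fun A => A (.inr m) (.inr i) * A (.inr (φ m)) (.inr i))
      (by fun_prop)
    have i4 := h.integrable (f := fun A => A (.inr i) (.inr m) * A (.inr (φ i)) (.inr (φ m)))
      (by fun_prop)
    rw [integral_add ?_ i4, integral_sub ?_ i3, integral_sub i1 i2,
      h.integral_mul_apply_of_ne (hinr (hφ₁ i).symm), h.integral_mul_apply_of_ne
      (hinr (hφ₁ m).symm), sub_zero, sub_zero]
    · exact i1.sub i2
    · exact (i1.sub i2).sub i3
  -- Some index occurs exactly once in the product: `i` if `φ i = m`, otherwise `m`. The first case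
  -- needs `i ≠ φ m`, which is where the absence of 2-cycles enters.
  have hcross : ∀ i, i ≠ m →
      ∫ ω, H ω (.inr i) (.inr m) * H ω (.inr (φ i)) (.inr (φ m)) ∂P = 0 := by
    intro i him
    by_cases hi : φ i = m
    · refine h.integral_mul_of_ne (hinr him) (hinr (hφ₁ i).symm) (hinr ?_)
      rintro rfl
      exact hφ₂ m hi
    · have := h.integral_mul_of_ne (hinr him.symm) (hinr (Ne.symm hi)) (hinr (hφ₁ m).symm)
      rw [← this]
      refine integral_congr_ae (.of_forall fun ω => ?_)
      simp only
      rw [h.symm_apply ω (.inr i)]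
  rw [integral_finsetSum _ fun i _ => h.integrable
    (f := fun A => A (.inr i) (.inr m) * diffEntry φ A i m) (by unfold diffEntry; fun_prop)]
  simp_rw [hterm]
  rw [← Finset.add_sum_erase _ _ (Finset.mem_univ m), Finset.sum_congr rfl fun k hk => by
    rw [hcross k (Finset.ne_of_mem_erase hk), add_zero,
      h.integral_sq_swap (hinr (hφ₁ m).symm) (hinr (Finset.ne_of_mem_erase hk).symm)]]
  rw [Finset.sum_const, Finset.card_erase_of_mem (Finset.mem_univ m), nsmul_eq_mul,
    Finset.card_univ, Fintype.card_fin, Nat.cast_sub (Fin.pos m), Nat.cast_one]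
  ring

lemma integral_diffEntry_self (h : IsInvariantProjection H r P) (φ : Equiv.Perm (Fin M₂))
    (hφ : ∀ i, φ i ≠ i) (m : Fin M₂) :
    ∫ ω, diffEntry φ (H ω) m m ∂P = 2 * (r / ((M₁ + M₂ : ℕ) : ℝ)) := by
  have hne : (Sum.inr m : Fin M₁ ⊕ Fin M₂) ≠ .inr (φ m) := fun hi =>
    hφ m (Sum.inr_injective hi).symm
  have i1 := h.integrable (f := fun A => A (.inr m) (.inr m)) (by fun_prop)
  have i2 := h.integrable (f := fun A => A (.inr (φ m)) (.inr m)) (by fun_prop)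
  have i3 := h.integrable (f := fun A => A (.inr m) (.inr (φ m))) (by fun_prop)
  have i4 := h.integrable (f := fun A => A (.inr (φ m)) (.inr (φ m))) (by fun_prop)
  unfold diffEntry
  rw [integral_add ?_ i4, integral_sub ?_ i3, integral_sub i1 i2, h.integral_diag,
    h.integral_diag, h.integral_apply_of_ne hne, h.integral_apply_of_ne hne.symm]
  · simp [two_mul]
  · exact i1.sub i2
  · exact (i1.sub i2).sub i3

/-- The expectation of `σ_η²` in terms of that of `term₁`. -/
lemma integral_sigma (h : IsInvariantProjection H r P) (hr : 1 ≤ r) (φ : Equiv.Perm (Fin M₂))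
    (hφ₁ : ∀ i, φ i ≠ i) (hφ₂ : ∀ i, φ (φ i) ≠ i) (m : Fin M₂) {M : ℕ} (hM : M = M₁ + M₂) :
    ∫ ω, 1 / (r : ℝ) * (∑ i, ∑ j, H ω (.inr i) (.inr m) * diffEntry φ (H ω) i j *
        H ω (.inr j) (.inr m) - 2 * ∑ i, H ω (.inr i) (.inr m) * diffEntry φ (H ω) i m +
          diffEntry φ (H ω) m m) ∂P =
      2 / (M : ℝ)
        - 2 * ((((M₂ : ℝ) * M + M - 4) * (M - r)) / ((M : ℝ) ^ 2 * (M - 1) * (M + 2)))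
        - 4 * r / (M : ℝ) ^ 2
        + 1 / r * ∫ ω, ∑ i, ∑ j, H ω (.inr i) (.inr m) * diffEntry φ (H ω) i j *
        H ω (.inr j) (.inr m) ∂P := by
  have hne : (Sum.inr m : Fin M₁ ⊕ Fin M₂) ≠ .inr (φ m) := fun hi =>
    hφ₁ m (Sum.inr_injective hi).symm
  have i1 := h.integrable (f := fun A => ∑ i, ∑ j, A (.inr i) (.inr m) * diffEntry φ A i j *
        A (.inr j) (.inr m)) (by unfold diffEntry; fun_prop)
  have i2 := h.integrable (f := fun A => 2 * ∑ i, A (.inr i) (.inr m) * diffEntry φ A i m)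
    (by unfold diffEntry; fun_prop)
  have i3 := h.integrable (f := fun A => diffEntry φ A m m) (by unfold diffEntry; fun_prop)
  rw [integral_const_mul, integral_add ?_ i3, integral_sub i1 i2, integral_const_mul,
    h.integral_sum_mul_diffEntry φ hφ₁ hφ₂, h.integral_diffEntry_self φ hφ₁]
  · have e1 := h.integral_sq_diag_add hne
    have e2 := h.integral_sq_diag_add_diag hne
    have e3 := h.integral_sq_diag_eq hne
    simp only [Fintype.card_sum, Fintype.card_fin] at e1 e2
    rw [← hM] at e1 e2 ⊢
    -- A permutation without fixed points needs two indices, which makes `M - 1` nonzero.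
    have hM2 : 2 ≤ M₂ := by
      have := Fin.ext_iff.not.1 (hφ₁ m)
      have h1 := m.2
      have h2 := (φ m).2
      omega
    have hMr : (2 : ℝ) ≤ M := by exact_mod_cast (by omega : 2 ≤ M)
    have hr' : (1 : ℝ) ≤ r := by exact_mod_cast hr
    set a := ∫ ω, H ω (.inr m) (.inr m) ^ 2 ∂P
    set c := ∫ ω, H ω (.inr m) (.inr (φ m)) ^ 2 ∂P
    set b := ∫ ω, H ω (.inr m) (.inr m) * H ω (.inr (φ m)) (.inr (φ m)) ∂P
    have h0 : (M : ℝ) ≠ 0 := by positivity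
    have h1 : (M : ℝ) - 1 ≠ 0 := by linarith
    have h2 : (M : ℝ) + 2 ≠ 0 := by positivity
    have hr0 : (r : ℝ) ≠ 0 := by positivity
    -- Adding the trace equation to twice the row equation produces `b + 2c`, which the reflection
    -- equation replaces by `a`.
    have ha : a = r * (r + 2) / (M * (M + 2)) := by
      field_simp at e1 e2 ⊢
      linear_combination e2 + 2 * e1 + (M : ℝ) * (M - 1) * e3
    have hc : c = r * (M - r) / (M * (M + 2) * (M - 1)) := by
      have : (M - 1) * c = r / M - a := by linarith
      rw [eq_div_of_mul_eq h1 ((mul_comm _ _).trans this), ha]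
      field_simp
      ring
    have hb : b = r * (r * M + r - 2) / (M * (M + 2) * (M - 1)) := by
      have : (M - 1) * b = r * (r / M) - a := by linarith
      rw [eq_div_of_mul_eq h1 ((mul_comm _ _).trans this), ha]
      field_simp
      ring
    rw [ha, hb, hc]
    field_simp
    ring
  · exact i1.sub i2

end IsInvariantProjection

end ShuffleMoments
-- The multivariate gamma quotient and its monotonicity.
section GammaRatio

lemma Gamma_add_mul_Gamma_le {x y s : ℝ} (hx : 0 < x) (hxy : x ≤ y) (hs : 0 ≤ s) :
    Real.Gamma (x + s) * Real.Gamma y ≤ Real.Gamma (y + s) * Real.Gamma x := by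
  rcases hs.eq_or_lt with rfl | hs
  · simp [mul_comm]
  have hy : 0 < y := hx.trans_le hxy
  have hd : 0 < y - x + s := by linarith
  have g1 := Real.Gamma_pos_of_pos hx
  have g2 := Real.Gamma_pos_of_pos hy
  have g3 := Real.Gamma_pos_of_pos (show 0 < x + s by linarith)
  have g4 := Real.Gamma_pos_of_pos (show 0 < y + s by linarith)
  -- Both `x + s` and `y` lie between `x` and `y + s`, with complementary weights `t` and `1 - t`;
  -- adding the two convexity inequalities for `log Γ` gives the claim.
  set t := s / (y - x + s) with ht
  have ht0 : 0 ≤ t := by positivity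
  have ht1 : 0 ≤ 1 - t := by
    rw [ht, sub_nonneg, div_le_one hd]; linarith
  have hts : t * (y - x + s) = s := div_mul_cancel₀ _ hd.ne'
  have h1 := Real.convexOn_log_Gamma.2 (show x ∈ Set.Ioi 0 from hx)
    (show y + s ∈ Set.Ioi 0 from by simp; linarith) ht1 ht0 (by ring)
  have h2 := Real.convexOn_log_Gamma.2 (show x ∈ Set.Ioi 0 from hx)
    (show y + s ∈ Set.Ioi 0 from by simp; linarith) ht0 ht1 (by ring)
  simp only [smul_eq_mul, Function.comp_apply] at h1 h2
  rw [show (1 - t) * x + t * (y + s) = x + s by linear_combination hts] at h1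
  rw [show t * x + (1 - t) * (y + s) = y by linear_combination -hts] at h2
  rw [← Real.log_le_log_iff (by positivity) (by positivity), Real.log_mul g3.ne' g2.ne',
    Real.log_mul g4.ne' g1.ne']
  linarith

lemma multiGamma_eq_prod_range (p : ℕ) (x : ℝ) :
    multiGamma p x = Real.pi ^ ((p : ℝ) * ((p : ℝ) - 1) / 4) *
      ∏ j ∈ Finset.range p, Real.Gamma (x - (j : ℝ) / 2) := by
  rw [multiGamma]
  congr 1
  generalize hq : p = q
  clear hq
  induction q with
  | zero => simp
  | succ q ih =>
    rw [Finset.prod_Icc_succ_top (by omega), Finset.prod_range_succ, ih]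
    simp

/-- The powers of `π` cancel, and the factor `j` is the beta moment of the column added after `j`
others. -/
lemma gammaRatio_eq_prod (r a M : ℕ) :
    gammaRatio r a M = ∏ j ∈ Finset.range r,
      Real.Gamma (((a : ℝ) - j) / 2 + 3 / r) * Real.Gamma (((M : ℝ) - j) / 2) /
      (Real.Gamma (((M : ℝ) - j) / 2 + 3 / r) * Real.Gamma (((a : ℝ) - j) / 2)) := by
  have h : (Real.pi ^ ((r : ℝ) * ((r : ℝ) - 1) / 4)) ≠ 0 := by positivity
  simp only [gammaRatio, multiGamma_eq_prod_range]
  rw [mul_mul_mul_comm, mul_mul_mul_comm (Real.pi ^ _) _ (Real.pi ^ _),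
    mul_div_mul_left _ _ (mul_ne_zero h h), ← Finset.prod_mul_distrib,
    ← Finset.prod_mul_distrib, ← Finset.prod_div_distrib]
  refine Finset.prod_congr rfl fun j _ => ?_
  rw [show (a : ℝ) / 2 + 3 / r - j / 2 = ((a : ℝ) - j) / 2 + 3 / r by ring,
    show (M : ℝ) / 2 + 3 / r - j / 2 = ((M : ℝ) - j) / 2 + 3 / r by ring,
    show (a : ℝ) / 2 - j / 2 = ((a : ℝ) - j) / 2 by ring,
    show (M : ℝ) / 2 - j / 2 = ((M : ℝ) - j) / 2 by ring]

lemma gammaRatio_le_gammaRatio {r a b M : ℕ} (hra : r ≤ a) (hab : a ≤ b) (hrM : r ≤ M) :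
    gammaRatio r a M ≤ gammaRatio r b M := by
  rw [gammaRatio_eq_prod, gammaRatio_eq_prod]
  have hs : (0 : ℝ) ≤ 3 / r := by positivity
  have hpos : ∀ j ∈ Finset.range r, ∀ c : ℕ, r ≤ c → (0 : ℝ) < ((c : ℝ) - j) / 2 := by
    intro j hj c hc
    have : (j : ℝ) < c := by exact_mod_cast (Finset.mem_range.1 hj).trans_le hc
    linarith
  have hab' : (a : ℝ) ≤ b := by exact_mod_cast hab
  refine Finset.prod_le_prod (fun j hj => ?_) fun j hj => ?_
  all_goals
    have g1 := Real.Gamma_pos_of_pos (hpos j hj a hra)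
    have g2 := Real.Gamma_pos_of_pos (hpos j hj M hrM)
    have g3 := Real.Gamma_pos_of_pos (add_pos_of_pos_of_nonneg (hpos j hj a hra) hs)
    have g4 := Real.Gamma_pos_of_pos (add_pos_of_pos_of_nonneg (hpos j hj M hrM) hs)
    have g5 := Real.Gamma_pos_of_pos (hpos j hj b (hra.trans hab))
  · positivity
  · have := Gamma_add_mul_Gamma_le (hpos j hj a hra)
      (show ((a : ℝ) - j) / 2 ≤ ((b : ℝ) - j) / 2 by linarith) hs
    rw [div_le_div_iff₀ (by positivity) (by positivity)]
    have h2 := mul_le_mul_of_nonneg_right this (mul_pos g2 g4).le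
    linarith

end GammaRatio

/-! ### From Gaussian entries to independent Gaussian columns. -/

section GaussianColumns

open Matrix WithLp

lemma map_uncurry_pi {m n α : Type*} [Fintype m] [Fintype n] [MeasurableSpace α] (μ : Measure α)
    [IsProbabilityMeasure μ] :
    (Measure.pi fun _ : n => Measure.pi fun _ : m => μ).map
      (fun x (p : m × n) => x p.2 p.1) = Measure.pi fun _ : m × n => μ := by
  symm
  refine Measure.pi_eq fun s hs => ?_
  rw [Measure.map_apply (measurable_pi_lambda _ fun p => by fun_prop) (.univ_pi hs)]
  have : (fun (x : n → m → α) (p : m × n) => x p.2 p.1) ⁻¹' Set.univ.pi s =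
      Set.univ.pi fun k => Set.univ.pi fun i => s (i, k) := by
    ext x
    simp only [Set.mem_preimage, Set.mem_univ_pi, Prod.forall]
    exact forall_comm
  rw [this, Measure.pi_pi]
  simp_rw [Measure.pi_pi]
  rw [Fintype.prod_prod_type, Finset.prod_comm]

lemma pi_stdGaussian_eq_map {m n : Type*} [Fintype m] [Fintype n] :
    (Measure.pi fun _ : n => stdGaussian (EuclideanSpace ℝ m)) =
      (Measure.pi fun _ : m × n => gaussianReal 0 1).map
        (fun x k => toLp 2 fun i => x (i, k)) := by
  rw [← map_uncurry_pi, Measure.map_map (by fun_prop)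
    (measurable_pi_lambda _ fun p => by fun_prop)]
  have : ∀ _ : n, SigmaFinite ((Measure.pi fun _ : m => gaussianReal 0 1).map (toLp 2)) := by
    intro _; rw [map_pi_eq_stdGaussian]; infer_instance
  simp_rw [← map_pi_eq_stdGaussian]
  rw [← Measure.pi_map_pi (fun _ => by fun_prop)]
  rfl

/-- The columns of a matrix, rescaled by `c`, as vectors of a Euclidean space. -/
noncomputable def scaledColumns {m n : Type*} (c : ℝ) (X : Matrix m n ℝ) :
    n → EuclideanSpace ℝ m := fun k => toLp 2 fun i => c * X i k

/-- The matrix with given columns. -/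
def ofColumns {m n : Type*} (v : n → EuclideanSpace ℝ m) : Matrix m n ℝ := of fun i k => v k i

lemma ofColumns_scaledColumns {m n : Type*} (c : ℝ) (X : Matrix m n ℝ) :
    ofColumns (scaledColumns c X) = c • X := rfl

lemma IsGaussianMatrix.map_scaledColumns {Ω m n : Type*} [MeasurableSpace Ω] [Fintype m]
    [Fintype n] {P : Measure Ω} [IsProbabilityMeasure P] {X : Ω → Matrix m n ℝ} {v : NNReal}
    (hX : IsGaussianMatrix X v P) {c : ℝ} (hc : c ^ 2 * v = 1) :
    AEMeasurable (fun ω => scaledColumns c (X ω)) P ∧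
    P.map (fun ω => scaledColumns c (X ω)) =
      Measure.pi fun _ : n => stdGaussian (EuclideanSpace ℝ m) := by
  have hlaw : ∀ p : m × n, HasLaw (fun ω => c * X ω p.1 p.2) (gaussianReal 0 1) P := by
    intro p
    have h := gaussianReal_const_mul (hX.1 p.1 p.2) c
    have e : NNReal.mk (c ^ 2) (sq_nonneg c) * v = 1 := by
      ext; simpa using hc
    simpa [e] using h
  have hm : ∀ p : m × n, AEMeasurable (fun ω => c * X ω p.1 p.2) P := fun p => (hlaw p).aemeasurable
  have hind : iIndepFun (fun (p : m × n) ω => c * X ω p.1 p.2) P :=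
    hX.2.comp (fun _ x => c * x) (fun _ => by fun_prop)
  have hmap := (iIndepFun_iff_map_fun_eq_pi_map hm).1 hind
  simp_rw [fun p => (hlaw p).map_eq] at hmap
  have hg : Measurable fun (x : m × n → ℝ) (k : n) => toLp 2 fun i => x (i, k) :=
    measurable_pi_lambda _ fun k => by fun_prop
  refine ⟨hg.comp_aemeasurable (aemeasurable_pi_lambda _ hm), ?_⟩
  rw [pi_stdGaussian_eq_map, ← hmap, AEMeasurable.map_map_of_aemeasurable hg.aemeasurable
    (aemeasurable_pi_lambda _ hm)]
  rfl

variable {m n : Type*} [Fintype m] [Fintype n]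

omit [Fintype n] in
lemma transpose_ofColumns_mul_ofColumns (v : n → EuclideanSpace ℝ m) :
    (ofColumns v)ᵀ * ofColumns v = gram ℝ v := by
  ext i j
  simp [ofColumns, mul_apply, PiLp.inner_apply, mul_comm]

variable [DecidableEq m] [DecidableEq n]

/-- An orthogonal `O` preserves the law of each column and conjugates the projection. Rank `r` holds
only almost surely, the algebraic identities everywhere. -/
lemma isInvariantProjection_hatMatrix {r : ℕ} (hr : r ≤ Fintype.card m) :
    IsInvariantProjection (fun v : Fin r → EuclideanSpace ℝ m => hatMatrix (ofColumns v)) r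
      (Measure.pi fun _ => stdGaussian (EuclideanSpace ℝ m)) := by
  have hcont : Continuous fun v : Fin r → EuclideanSpace ℝ m => ofColumns v :=
    continuous_matrix fun i k => by simp only [ofColumns, of_apply]; fun_prop
  have hmeas : ∀ i j, Measurable
      fun v : Fin r → EuclideanSpace ℝ m => hatMatrix (ofColumns v) i j := by
    intro i j
    have hW : Continuous fun v : Fin r → EuclideanSpace ℝ m => (ofColumns v)ᵀ * ofColumns v :=
      hcont.matrix_transpose.matrix_mul hcont
    have hN : Continuous fun v : Fin r → EuclideanSpace ℝ m =>
        (ofColumns v * ((ofColumns v)ᵀ * ofColumns v).adjugate * (ofColumns v)ᵀ) i j :=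
      ((hcont.matrix_mul hW.matrix_adjugate).matrix_mul hcont.matrix_transpose).matrix_elem i j
    -- The adjugate formula shows measurability, including where the determinant is zero.
    have e : ∀ v : Fin r → EuclideanSpace ℝ m, hatMatrix (ofColumns v) i j =
        (((ofColumns v)ᵀ * ofColumns v).det)⁻¹ *
          (ofColumns v * ((ofColumns v)ᵀ * ofColumns v).adjugate * (ofColumns v)ᵀ) i j := by
      intro v
      rw [hatMatrix, inv_def, Ring.inverse_eq_inv', Matrix.mul_smul, Matrix.smul_mul,
        Matrix.smul_apply, smul_eq_mul]
    simp_rw [e]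
    exact hW.matrix_det.measurable.inv.mul hN.measurable
  refine ⟨hmeas, fun v => hatMatrix_transpose _, fun v => hatMatrix_mul_self _, ?_, ?_⟩
  · filter_upwards [ae_det_gram_ne_zero (E := EuclideanSpace ℝ m) (n := r) (by simpa using hr)]
      with v hv
    rw [trace_hatMatrix _ (by rwa [transpose_ofColumns_mul_ofColumns]), Fintype.card_fin]
  · intro O hO f hf
    set T : EuclideanSpace ℝ m →L[ℝ] EuclideanSpace ℝ m := toEuclideanCLM (𝕜 := ℝ) O with hT
    have hTa : ∀ y, ‖ContinuousLinearMap.adjoint T y‖ = ‖y‖ := by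
      intro y
      have hTT : T (ContinuousLinearMap.adjoint T y) = y := by
        have h1 : T * star T = 1 := by
          rw [hT, ← map_star, ← map_mul, star_eq_conjTranspose,
            conjTranspose_eq_transpose_of_trivial, mul_eq_one_comm.1 hO, map_one]
        exact congrArg (fun S : EuclideanSpace ℝ m →L[ℝ] EuclideanSpace ℝ m => S y) h1
      have h2 : ‖ContinuousLinearMap.adjoint T y‖ ^ 2 = ‖y‖ ^ 2 := by
        rw [← real_inner_self_eq_norm_sq, ContinuousLinearMap.adjoint_inner_left, hTT,
          real_inner_self_eq_norm_sq]
      exact (pow_left_inj₀ (norm_nonneg _) (norm_nonneg _) two_ne_zero).1 h2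
    have hmap : (Measure.pi fun _ : Fin r => stdGaussian (EuclideanSpace ℝ m)).map
        (fun v k => T (v k)) = Measure.pi fun _ => stdGaussian (EuclideanSpace ℝ m) := by
      have : ∀ i : Fin r, SigmaFinite ((stdGaussian (EuclideanSpace ℝ m)).map T) := fun i => by
        rw [stdGaussian_map_of_norm_adjoint T hTa]; infer_instance
      rw [Measure.pi_map_pi (fun i => by fun_prop)]
      simp_rw [stdGaussian_map_of_norm_adjoint T hTa]
    have hTm : Measurable fun (v : Fin r → EuclideanSpace ℝ m) k => T (v k) :=
      measurable_pi_lambda _ fun i => T.measurable.comp (measurable_pi_apply i)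
    have key : ∀ g : (m → m → ℝ) → ℝ, Continuous g → Measurable g := fun g hg => hg.measurable
    have hfm : Measurable fun v : Fin r → EuclideanSpace ℝ m => f (hatMatrix (ofColumns v)) :=
      (key f hf).comp (measurable_pi_lambda _ fun i => measurable_pi_lambda _ fun j => hmeas i j)
    nth_rw 1 [← hmap]
    rw [integral_map hTm.aemeasurable hfm.aestronglyMeasurable]
    refine integral_congr_ae (.of_forall fun v => ?_)
    have : ofColumns (fun k => T (v k)) = O * ofColumns v := by
      ext i k
      simp [ofColumns, hT, mul_apply, mulVec, dotProduct]
    simp only [this, hatMatrix_orthogonal_mul _ hO]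

end GaussianColumns
-- Restriction to the shuffled coordinates as a co-isometry.
section LowerBlock

open Matrix WithLp

variable {M₁ M₂ r : ℕ}

/-- The restriction of a vector to the lower block of coordinates. -/
noncomputable def lowerRestrict (M₁ M₂ : ℕ) :
    EuclideanSpace ℝ (Fin M₁ ⊕ Fin M₂) →L[ℝ] EuclideanSpace ℝ (Fin M₂) :=
  LinearMap.toContinuousLinearMap
    { toFun := fun x => toLp 2 fun i => x (.inr i)
      map_add' := fun _ _ => rfl
      map_smul' := fun _ _ => rfl }

lemma lowerRestrict_apply (x : EuclideanSpace ℝ (Fin M₁ ⊕ Fin M₂)) (i : Fin M₂) :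
    lowerRestrict M₁ M₂ x i = x (.inr i) := rfl

lemma norm_adjoint_lowerRestrict (y : EuclideanSpace ℝ (Fin M₂)) :
    ‖ContinuousLinearMap.adjoint (lowerRestrict M₁ M₂) y‖ = ‖y‖ := by
  -- The adjoint is extension by zero.
  have h : ContinuousLinearMap.adjoint (lowerRestrict M₁ M₂) y = toLp 2 (Sum.elim (0 : Fin M₁ → ℝ) y) := by
    refine ext_inner_right ℝ fun x => ?_
    rw [ContinuousLinearMap.adjoint_inner_left]
    simp [PiLp.inner_apply, lowerRestrict_apply]
  rw [h, EuclideanSpace.norm_eq, EuclideanSpace.norm_eq]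
  simp

lemma toRows₂_transpose_mul_toRows₂_ofColumns
    (v : Fin r → EuclideanSpace ℝ (Fin M₁ ⊕ Fin M₂)) :
    (ofColumns v).toRows₂ᵀ * (ofColumns v).toRows₂ = gram ℝ (lowerRestrict M₁ M₂ ∘ v) := by
  rw [← transpose_ofColumns_mul_ofColumns]
  rfl

lemma det_smul_transpose_mul_smul {m : Type*} [Fintype m] (A : Matrix m (Fin r) ℝ) (c : ℝ) :
    ((c • A)ᵀ * (c • A)).det = (c * c) ^ r * (Aᵀ * A).det := by
  rw [transpose_smul, Matrix.smul_mul, Matrix.mul_smul, smul_smul, det_smul, Fintype.card_fin]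

/-- By cyclicity of the trace, the cubes of `U⁽²⁾ U⁽²⁾ᵀ` and of `U⁽²⁾ᵀ U⁽²⁾` have equal trace; AM-GM
applies to the second. -/
lemma card_mul_det_gram₂_rpow_le (hr : 1 ≤ r) (U : Matrix (Fin M₁ ⊕ Fin M₂) (Fin r) ℝ) :
    (r : ℝ) * (gram₂ U).det ^ (3 / (r : ℝ)) ≤
      ((U * Uᵀ).toBlocks₂₂ * (U * Uᵀ).toBlocks₂₂ * (U * Uᵀ).toBlocks₂₂).trace := by
  have : Nonempty (Fin r) := ⟨⟨0, hr⟩⟩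
  have hb : (U * Uᵀ).toBlocks₂₂ = U.toRows₂ * U.toRows₂ᵀ := rfl
  have hpsd : (gram₂ U).PosSemidef := by
    simpa [gram₂] using posSemidef_conjTranspose_mul_self U.toRows₂
  have h := card_mul_det_rpow_le_trace_mul_mul hpsd
  rw [Fintype.card_fin] at h
  refine h.trans_eq ?_
  rw [hb, gram₂]
  simp only [Matrix.mul_assoc]
  rw [trace_mul_comm U.toRows₂]
  simp only [Matrix.mul_assoc]

lemma lintegral_det_ratio_eq_gammaRatio {M : ℕ} (hM : M = M₁ + M₂) (hrM₂ : r ≤ M₂) :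
    ∫⁻ v, ENNReal.ofReal (((gram ℝ (lowerRestrict M₁ M₂ ∘ v)).det / (gram ℝ v).det) ^
      (3 / (r : ℝ))) ∂(Measure.pi fun _ : Fin r => stdGaussian
        (EuclideanSpace ℝ (Fin M₁ ⊕ Fin M₂))) = ENNReal.ofReal (gammaRatio r M₂ M) := by
  rw [lintegral_det_gram_ratio_rpow _ norm_adjoint_lowerRestrict (by positivity) (by simpa),
    gammaRatio_eq_prod]
  simp [hM]

end LowerBlock

/-! ### Assembly of the four claims. -/

open Matrix in
theorem mainTheorem2 {Ω : Type*} [MeasurableSpace Ω] (P : Measure Ω) [IsProbabilityMeasure P]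
    (M₁ M₂ M r : ℕ) (hM : M = M₁ + M₂) (hr : 1 ≤ r) (hrM₂ : r ≤ M₂)
    (φ : Equiv.Perm (Fin M₂)) (hφ₁ : ∀ i, φ i ≠ i) (hφ₂ : ∀ i, φ (φ i) ≠ i) (m : Fin M₂)
    (X : Ω → Matrix (Fin M₁ ⊕ Fin M₂) (Fin r) ℝ)
    (hX : IsGaussianMatrix X (1 / (M : NNReal)) P)
    (U : Ω → Matrix (Fin M₁ ⊕ Fin M₂) (Fin r) ℝ)
    (hU : ∀ ω, U ω = orthonormalize (X ω)) :
    Integrable (fun ω => term₁ φ m (U ω)) P ∧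
    Integrable (fun ω => (gram₂ (U ω)).det ^ (3 / (r : ℝ))) P ∧
    Integrable (fun ω => sigmaEtaSq φ m (U ω)) P ∧
    (r : ℝ) / M₂ * ∫ ω, (gram₂ (U ω)).det ^ (3 / (r : ℝ)) ∂P ≤ ∫ ω, term₁ φ m (U ω) ∂P ∧
    ∫ ω, (gram₂ (U ω)).det ^ (3 / (r : ℝ)) ∂P = gammaRatio r M₂ M ∧
    (r : ℝ) / M₂ * gammaRatio r r M ≤ ∫ ω, term₁ φ m (U ω) ∂P ∧
    2 / (M : ℝ)
        - 2 * ((((M₂ : ℝ) * M + M - 4) * (M - r)) / ((M : ℝ) ^ 2 * (M - 1) * (M + 2)))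
        - 4 * r / (M : ℝ) ^ 2
        + gammaRatio r M₂ M / M₂
      ≤ ∫ ω, sigmaEtaSq φ m (U ω) ∂P := by
  have hM0 : (0 : ℝ) < M := by exact_mod_cast (by omega : 0 < M)
  have hr0 : (0 : ℝ) < r := by exact_mod_cast hr
  have hM₂0 : (0 : ℝ) < M₂ := by exact_mod_cast (by omega : 0 < M₂)
  have hc0 : √(M : ℝ) ≠ 0 := (Real.sqrt_pos.2 hM0).ne'
  -- The factor `√M` turns variance `1/M` into variance one.
  set V : Ω → Fin r → EuclideanSpace ℝ (Fin M₁ ⊕ Fin M₂) :=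
    fun ω => scaledColumns (√M) (X ω) with hV
  set π := Measure.pi fun _ : Fin r => stdGaussian (EuclideanSpace ℝ (Fin M₁ ⊕ Fin M₂)) with hπ
  obtain ⟨hVm, hVmap⟩ : AEMeasurable V P ∧ P.map V = π :=
    hX.map_scaledColumns (c := √M) (by
      rw [Real.sq_sqrt hM0.le]; push_cast; field_simp)
  set K : (Fin r → EuclideanSpace ℝ (Fin M₁ ⊕ Fin M₂)) → Matrix _ _ ℝ :=
    fun v => hatMatrix (ofColumns v) with hK
  have hinv : IsInvariantProjection K r π := isInvariantProjection_hatMatrix (by simp; omega)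
  set ρ : (Fin r → EuclideanSpace ℝ (Fin M₁ ⊕ Fin M₂)) → ℝ := fun v =>
    ((gram ℝ (lowerRestrict M₁ M₂ ∘ v)).det / (gram ℝ v).det) ^ (3 / (r : ℝ)) with hρ
  have hρ0 : ∀ v, 0 ≤ ρ v := fun v =>
    Real.rpow_nonneg (div_nonneg (det_gram_nonneg _) (det_gram_nonneg _)) _
  -- Almost surely the columns are independent.
  have hdet : ∀ᵐ ω ∂P, ((X ω)ᵀ * X ω).det ≠ 0 := by
    have h := ae_det_gram_ne_zero (E := EuclideanSpace ℝ (Fin M₁ ⊕ Fin M₂)) (n := r)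
      (by simp; omega)
    rw [← hπ, ← hVmap] at h
    filter_upwards [ae_of_ae_map hVm h] with ω hω
    rw [← transpose_ofColumns_mul_ofColumns, hV, ofColumns_scaledColumns,
      det_smul_transpose_mul_smul] at hω
    exact right_ne_zero_of_mul hω
  have hUK : ∀ᵐ ω ∂P, U ω * (U ω)ᵀ = K (V ω) := by
    filter_upwards [hdet] with ω hω
    rw [hU, orthonormalize_mul_transpose _ hω, hK, hV]
    simp only [ofColumns_scaledColumns]
    rw [hatMatrix_smul _ hc0]
  have hUρ : (fun ω => (gram₂ (U ω)).det ^ (3 / (r : ℝ))) =ᵐ[P] fun ω => ρ (V ω) := by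
    filter_upwards [hdet] with ω hω
    simp only [hρ]
    rw [← transpose_ofColumns_mul_ofColumns (V ω), ← toRows₂_transpose_mul_toRows₂_ofColumns, hU,
      det_gram₂_orthonormalize _ hω, hV, ofColumns_scaledColumns]
    have : (√(M : ℝ) • X ω).toRows₂ = √(M : ℝ) • (X ω).toRows₂ := rfl
    rw [this, det_smul_transpose_mul_smul, det_smul_transpose_mul_smul,
      mul_div_mul_left _ _ (by positivity)]
  -- Transfer of expectations to the Gaussian columns.
  have htransfer : ∀ {Y : Ω → ℝ} {g : (Fin r → EuclideanSpace ℝ (Fin M₁ ⊕ Fin M₂)) → ℝ},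
      Y =ᵐ[P] (fun ω => g (V ω)) → Integrable g π →
        Integrable Y P ∧ ∫ ω, Y ω ∂P = ∫ v, g v ∂π := by
    intro Y g hY hg
    rw [← hVmap] at hg ⊢
    refine ⟨(hg.comp_aemeasurable hVm).congr hY.symm, ?_⟩
    rw [integral_map hVm hg.aestronglyMeasurable, integral_congr_ae hY]
  have hlint : ∫⁻ v, ENNReal.ofReal (ρ v) ∂π = ENNReal.ofReal (gammaRatio r M₂ M) :=
    lintegral_det_ratio_eq_gammaRatio hM hrM₂
  have hρm : Measurable ρ := by
    have h1 : Measurable fun v : Fin r → EuclideanSpace ℝ (Fin M₁ ⊕ Fin M₂) =>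
        (gram ℝ (lowerRestrict M₁ M₂ ∘ v)).det :=
      measurable_det_gram.comp (g := fun w : Fin r → EuclideanSpace ℝ (Fin M₂) => (gram ℝ w).det)
        (f := fun v => lowerRestrict M₁ M₂ ∘ v) (measurable_pi_lambda _ fun i =>
          (lowerRestrict M₁ M₂).measurable.comp (measurable_pi_apply i))
    exact (h1.div measurable_det_gram).pow_const _
  have hρi : Integrable ρ π :=
    ⟨hρm.aestronglyMeasurable, by
      rw [hasFiniteIntegral_iff_ofReal (.of_forall hρ0), hlint]; exact ENNReal.ofReal_lt_top⟩
  have hρe : ∫ v, ρ v ∂π = gammaRatio r M₂ M := by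
    rw [integral_eq_lintegral_of_nonneg_ae (.of_forall hρ0) hρm.aestronglyMeasurable, hlint,
      ENNReal.toReal_ofReal]
    -- `ENNReal.ofReal` truncates negative values, so the quotient must be shown nonnegative.
    rw [gammaRatio_eq_prod]
    refine Finset.prod_nonneg fun j hj => ?_
    have hj' : (j : ℝ) + 1 ≤ r := by exact_mod_cast Finset.mem_range.1 hj
    have h1 : (r : ℝ) ≤ M₂ := by exact_mod_cast hrM₂
    have h2 : (r : ℝ) ≤ M := by exact_mod_cast (by omega : r ≤ M)
    have h3 : (0 : ℝ) ≤ 3 / r := by positivity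
    have := Real.Gamma_pos_of_pos (show (0 : ℝ) < ((M₂ : ℝ) - j) / 2 by linarith)
    have := Real.Gamma_pos_of_pos (show (0 : ℝ) < ((M : ℝ) - j) / 2 by linarith)
    have := Real.Gamma_pos_of_pos (show (0 : ℝ) < ((M₂ : ℝ) - j) / 2 + 3 / r by linarith)
    have := Real.Gamma_pos_of_pos (show (0 : ℝ) < ((M : ℝ) - j) / 2 + 3 / r by linarith)
    positivity
  obtain ⟨iG, eG⟩ := htransfer hUρ hρi
  rw [hρe] at eG
  have hT1 : (fun ω => term₁ φ m (U ω)) =ᵐ[P] fun ω => ∑ i, ∑ j, K (V ω) (.inr i) (.inr m) *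
      diffEntry φ (K (V ω)) i j * K (V ω) (.inr j) (.inr m) := by
    filter_upwards [hUK] with ω hω
    rw [term₁_eq, hω]
  have hS : (fun ω => sigmaEtaSq φ m (U ω)) =ᵐ[P] fun ω => 1 / (r : ℝ) *
      (∑ i, ∑ j, K (V ω) (.inr i) (.inr m) *
      diffEntry φ (K (V ω)) i j * K (V ω) (.inr j) (.inr m) -
        2 * ∑ i, K (V ω) (.inr i) (.inr m) * diffEntry φ (K (V ω)) i m +
          diffEntry φ (K (V ω)) m m) := by
    filter_upwards [hUK] with ω hω
    rw [sigmaEtaSq_eq, term₁_eq, hω]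
  obtain ⟨iT, eT⟩ := htransfer (g := fun v => ∑ i, ∑ j, K v (.inr i) (.inr m) *
      diffEntry φ (K v) i j * K v (.inr j) (.inr m)) hT1
    (hinv.integrable (f := fun A => ∑ i, ∑ j, A (.inr i) (.inr m) * diffEntry φ A i j *
        A (.inr j) (.inr m)) (by unfold diffEntry; fun_prop))
  obtain ⟨iS, eS⟩ := htransfer (g := fun v => 1 / (r : ℝ) *
      (∑ i, ∑ j, K v (.inr i) (.inr m) * diffEntry φ (K v) i j * K v (.inr j) (.inr m) -
        2 * ∑ i, K v (.inr i) (.inr m) * diffEntry φ (K v) i m + diffEntry φ (K v) m m)) hS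
    (hinv.integrable (f := fun A => 1 / (r : ℝ) * (∑ i, ∑ j, A (.inr i) (.inr m) *
      diffEntry φ A i j * A (.inr j) (.inr m) - 2 * ∑ i, A (.inr i) (.inr m) * diffEntry φ A i m +
        diffEntry φ A m m)) (by unfold diffEntry; fun_prop))
  have hTr : (fun ω => ((U ω * (U ω)ᵀ).toBlocks₂₂ * (U ω * (U ω)ᵀ).toBlocks₂₂ *
      (U ω * (U ω)ᵀ).toBlocks₂₂).trace) =ᵐ[P]
      fun ω => ((K (V ω)).toBlocks₂₂ * (K (V ω)).toBlocks₂₂ * (K (V ω)).toBlocks₂₂).trace := by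
    filter_upwards [hUK] with ω hω
    rw [hω]
  obtain ⟨iTr, eTr⟩ := htransfer
    (g := fun v => ((K v).toBlocks₂₂ * (K v).toBlocks₂₂ * (K v).toBlocks₂₂).trace) hTr
    (hinv.integrable (f := fun A => (A.toBlocks₂₂ * A.toBlocks₂₂ * A.toBlocks₂₂).trace) (by
      simp only [trace, diag_apply, mul_apply, toBlocks₂₂, of_apply]; fun_prop))
  have hbound : (r : ℝ) / M₂ * gammaRatio r M₂ M ≤ ∫ ω, term₁ φ m (U ω) ∂P := by
    have h1 := hinv.integral_trace_cube_le φ hφ₁ m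
    rw [← eTr, ← eT] at h1
    -- The trace bound holds for every matrix `U ω`, so it is integrated before passing to the
    -- Gaussian columns.
    have h2 := integral_mono (iG.const_mul (r : ℝ)) iTr fun ω =>
      card_mul_det_gram₂_rpow_le hr (U ω)
    rw [integral_const_mul, eG] at h2
    calc _ = 1 / (M₂ : ℝ) * (r * gammaRatio r M₂ M) := by ring
      _ ≤ _ := (mul_le_mul_of_nonneg_left h2 (by positivity)).trans h1
  refine ⟨iT, iG, iS, by rwa [eG], eG, ?_, ?_⟩
  · refine le_trans ?_ hbound
    exact mul_le_mul_of_nonneg_left (gammaRatio_le_gammaRatio le_rfl hrM₂ (by omega))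
      (by positivity)
  · rw [eS, hinv.integral_sigma hr φ hφ₁ hφ₂ m hM, ← eT]
    have : gammaRatio r M₂ M / M₂ = 1 / r * (r / M₂ * gammaRatio r M₂ M) := by field_simp
    rw [this]
    gcongr
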